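/- Let $\mathbb{Y}$ be a Polish space with its Borel $\sigma$-algebra, $\mu$ a $\sigma$-finite Borel measure on $\mathbb{Y}$, and $\mathbb{F}$ the set of all probability densities with respect to $\mu$ (modulo equality $\mu$-a.e.), with the Hellinger metric $H(f,g)=\{\int(f^{1/2}-g^{1/2})^2\,d\mu\}^{1/2}$ and its Borel $\sigma$-algebra. Let the prior $\Pi$ be a Borel probability measure on $\mathbb{F}$, let $f^\star\in\mathbb{F}$, and let $Y_1,Y_2,\dots$ be iid with density $f^\star$ on a probability space with probability $\mathsf{P}$. For $A\subseteq\mathbb{F}$ measurable let $$\Pi_n(A)=\frac{\int_A\prod_{i=1}^n f(Y_i)\,\Pi(df)}{\int_{\mathbb{F}}\prod_{i=1}^n f(Y_i)\,\Pi(df)}$$ be the posterior distribution, where $f(y)$ is computed from any jointly measurable map $(f,y)\mapsto p(f,y)\in[0,\infty)$ with $p(f,\cdot)=f$ $\mu$-a.e. for every $f\in\mathbb{F}$. Let $(\varepsilon_n)$ be a positive sequence with $\varepsilon_n\to0$ and $n\varepsilon_n^2\to\infty$, let $K(f^\star,f)=\int\log(f^\star/f)f^\star\,d\mu$ and $V(f^\star,f)=\int\{\log(f^\star/f)\}^2f^\star\,d\mu$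 (both in $[0,\infty]$), and suppose that $\Pi$ is $\varepsilon_n$-thick at $f^\star$ with a constant $C>0$: for all sufficiently large $n$, $$\Pi(\{f: K(f^\star,f)\le\varepsilon_n^2,\ V(f^\star,f)\le\varepsilon_n^2\})\ge e^{-Cn\varepsilon_n^2}.$$ Suppose also that at least one of the following conditions holds. Condition S. There are measurable sets $\mathbb{F}_n\subseteq\mathbb{F}$ and constants $r>C+1$, $D>0$, $R>0$ such that, for all sufficiently large $n$, $\Pi(\mathbb{F}_n^c)\le De^{-rn\varepsilon_n^2}$ and $\log N(\varepsilon_n,\mathbb{F}_n,H)\le Rn\varepsilon_n^2$, where $N(\varepsilon,S,H)$ is the minimal number of Hellinger balls of radius $\varepsilon$, centred in $\mathbb{F}$, that cover $S$. Condition P. There are radii $\delta_n$ and countable families $\{A_{n,j}\}_j$ such that, for all sufficiently large $n$, $0<\delta_n<\varepsilon_n$, every $A_{n,j}$ is a Hellinger ball of radius $\delta_n$, and the $A_{n,j}$ cover $\{f:H(f^\star,f)>\varepsilon_n\}$; and there are constants $c>0$ and $\beta>1$ such that $e^{-cn\varepsilon_n^2}\sum_j\Pi(A_{n,j})^{1/\beta}\to0$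 as $n\to\infty$. Then, for all sufficiently large $n$, the denominator of $\Pi_n$ is almost surely positive and finite, and there is a constant $M>0$ such that $\Pi_n(\{f:H(f^\star,f)\ge M\varepsilon_n\})\to0$ in $\mathsf{P}$-probability as $n\to\infty$. -/

import Mathlib

open MeasureTheory ProbabilityTheory Filter Topology Set
open scoped NNReal ENNReal

noncomputable section

namespace BayesRate

/-- The set `𝔽` of all probability densities with respect to `μ`, as classes of
functions modulo equality `μ`-almost everywhere. -/
def Density {𝕐 : Type*} [MeasurableSpace 𝕐] (μ : Measure 𝕐) : Type _ :=
  {f : 𝕐 →ₘ[μ] ℝ≥0 // ∫⁻ y, (f y : ℝ≥0∞) ∂μ = 1}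

section Density

variable {𝕐 : Type*} [MeasurableSpace 𝕐] {μ : Measure 𝕐}

instance : CoeFun (Density μ) (fun _ => 𝕐 → ℝ≥0) := ⟨fun f => ⇑f.1⟩

theorem Density.measurable (f : Density μ) : Measurable (f : 𝕐 → ℝ≥0) := f.1.measurable

/-- The distribution `F` with density `f`. -/
def Density.law (f : Density μ) : Measure 𝕐 := μ.withDensity (fun y => (f y : ℝ≥0∞))

/-- The Hellinger distance `H(f, g) = {∫ (f^{1/2} - g^{1/2})² dμ}^{1/2}`. -/
def hellinger (f g : Density μ) : ℝ :=
  √(∫ y, (√(f y : ℝ) - √(g y : ℝ)) ^ 2 ∂μ)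

theorem memLp_sqrt (f : Density μ) : MemLp (fun y => √(f y : ℝ)) 2 μ := by
  have hm : Measurable (fun y => √(f y : ℝ)) := f.measurable.coe_nnreal_real.sqrt
  rw [memLp_two_iff_integrable_sq hm.aestronglyMeasurable]
  simp only [Real.sq_sqrt (NNReal.coe_nonneg _)]
  refine ⟨f.measurable.coe_nnreal_real.aestronglyMeasurable, ?_⟩
  rw [hasFiniteIntegral_iff_enorm]
  have : ∀ y, ‖((f y : ℝ≥0) : ℝ)‖ₑ = (f y : ℝ≥0∞) := fun y => by
    rw [← ofReal_norm, Real.norm_of_nonneg (NNReal.coe_nonneg _), ENNReal.ofReal_coe_nnreal]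
  simp only [this]
  rw [f.2]
  exact ENNReal.one_lt_top

/-- The square root of a density as an element of `L²(μ)`. -/
def sqrtL2 (f : Density μ) : Lp ℝ 2 μ := (memLp_sqrt f).toLp _

theorem hellinger_eq_dist (f g : Density μ) : hellinger f g = dist (sqrtL2 f) (sqrtL2 g) := by
  rw [dist_eq_norm, hellinger, sqrtL2, sqrtL2, ← MemLp.toLp_sub, norm_eq_sqrt_real_inner]
  congr 1
  rw [L2.inner_def]
  refine integral_congr_ae ?_
  filter_upwards [((memLp_sqrt f).sub (memLp_sqrt g)).coeFn_toLp] with y hy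
  rw [hy]
  simp [sq]

theorem sqrtL2_injective : Function.Injective (sqrtL2 : Density μ → Lp ℝ 2 μ) := by
  intro f g h
  have h' := (MemLp.toLp_eq_toLp_iff (memLp_sqrt f) (memLp_sqrt g)).1 h
  refine Subtype.ext (AEEqFun.ext ?_)
  filter_upwards [h'] with y hy
  exact NNReal.coe_injective
    ((Real.sqrt_inj (NNReal.coe_nonneg _) (NNReal.coe_nonneg _)).1 hy)

/-- `𝔽` carries the Hellinger metric and its topology. -/
instance : MetricSpace (Density μ) where
  dist := hellinger
  dist_self f := by rw [hellinger_eq_dist, dist_self]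
  dist_comm f g := by rw [hellinger_eq_dist, hellinger_eq_dist, dist_comm]
  dist_triangle f g k := by
    rw [hellinger_eq_dist, hellinger_eq_dist, hellinger_eq_dist]
    exact dist_triangle _ _ _
  eq_of_dist_eq_zero {f g} h := by
    rw [hellinger_eq_dist] at h
    exact sqrtL2_injective (dist_eq_zero.1 h)

theorem dist_eq_hellinger (f g : Density μ) : dist f g = hellinger f g := rfl

/-- The Borel `σ`-algebra of the Hellinger topology. -/
instance : MeasurableSpace (Density μ) := borel _

instance : BorelSpace (Density μ) := ⟨rfl⟩

/-- `p f y` is a jointly measurable choice of the value `f(y)`; it is what makes sense of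
`∫ ∏ f(Y_i) Π(df)`. -/
structure IsVersion (p : Density μ → 𝕐 → ℝ≥0) : Prop where
  measurable : Measurable (Function.uncurry p)
  ae_eq : ∀ f : Density μ, p f =ᵐ[μ] f

theorem isometry_sqrtL2 : Isometry (sqrtL2 : Density μ → Lp ℝ 2 μ) :=
  Isometry.of_dist_eq fun f g => (hellinger_eq_dist f g).symm

theorem law_apply (f : Density μ) {s : Set 𝕐} (hs : MeasurableSet s) :
    f.law s = ENNReal.ofReal (‖LpToLpRestrictCLM 𝕐 ℝ ℝ μ 2 s (sqrtL2 f)‖ ^ 2) := by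
  have hae : LpToLpRestrictCLM 𝕐 ℝ ℝ μ 2 s (sqrtL2 f) =ᵐ[μ.restrict s]
      fun y => √(f y : ℝ) :=
    (LpToLpRestrictCLM_coeFn ℝ s (sqrtL2 f)).trans
      (ae_restrict_of_ae (memLp_sqrt f).coeFn_toLp)
  rw [← real_inner_self_eq_norm_sq, L2.inner_def, Density.law, withDensity_apply _ hs]
  have h1 : ∫ y, inner ℝ ((LpToLpRestrictCLM 𝕐 ℝ ℝ μ 2 s (sqrtL2 f)) y)
      ((LpToLpRestrictCLM 𝕐 ℝ ℝ μ 2 s (sqrtL2 f)) y) ∂(μ.restrict s)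
      = ∫ y, (f y : ℝ) ∂(μ.restrict s) := by
    refine integral_congr_ae ?_
    filter_upwards [hae] with y hy
    rw [hy]
    simp
  rw [h1, integral_eq_lintegral_of_nonneg_ae (ae_of_all _ fun y => NNReal.coe_nonneg _)
    f.measurable.coe_nnreal_real.aestronglyMeasurable]
  simp only [ENNReal.ofReal_coe_nnreal]
  rw [ENNReal.ofReal_toReal]
  have : ∫⁻ y in s, (f y : ℝ≥0∞) ∂μ ≤ 1 := (setLIntegral_le_lintegral s _).trans f.2.le
  exact ne_top_of_le_ne_top ENNReal.one_ne_top this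

theorem law_univ (f : Density μ) : f.law univ = 1 := by
  rw [Density.law, withDensity_apply _ MeasurableSet.univ, Measure.restrict_univ]
  exact f.2

theorem measurable_law : Measurable (Density.law : Density μ → Measure 𝕐) := by
  refine Measure.measurable_of_measurable_coe _ fun s hs => ?_
  simp only [law_apply _ hs]
  exact ENNReal.measurable_ofReal.comp
    (((LpToLpRestrictCLM 𝕐 ℝ ℝ μ 2 s).continuous.comp
      isometry_sqrtL2.continuous).norm.pow 2).measurable

/-- Jointly measurable versions exist. -/
theorem exists_isVersion [MeasurableSpace.CountablyGenerated 𝕐] [SigmaFinite μ] :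
    ∃ p : Density μ → 𝕐 → ℝ≥0, IsVersion p := by
  let κ : Kernel (Density μ) 𝕐 := ⟨Density.law, measurable_law⟩
  have : IsMarkovKernel κ := ⟨fun f => ⟨law_univ f⟩⟩
  let η : Kernel (Density μ) 𝕐 := Kernel.const _ μ.toFinite
  let g : 𝕐 → ℝ≥0∞ := μ.toFinite.rnDeriv μ
  refine ⟨fun f y => (Kernel.rnDeriv κ η f y * g y).toNNReal, ?_, fun f => ?_⟩
  · refine Measurable.ennreal_toNNReal ?_
    exact (Kernel.measurable_rnDeriv κ η).mul
      ((Measure.measurable_rnDeriv _ _).comp measurable_snd)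
  · have hμ : μ.toFinite ≪ μ := toFinite_absolutelyContinuous μ
    have hf : f.law ≪ μ := withDensity_absolutelyContinuous _ _
    have h1 : Kernel.rnDeriv κ η f =ᵐ[μ] f.law.rnDeriv μ.toFinite :=
      (absolutelyContinuous_toFinite μ).ae_le (Kernel.rnDeriv_eq_rnDeriv_measure (κ := κ) (η := η))
    have : SigmaFinite f.law := by
      have : IsFiniteMeasure f.law := ⟨by rw [law_univ]; exact ENNReal.one_lt_top⟩
      infer_instance
    have h2 : f.law.rnDeriv μ.toFinite * μ.toFinite.rnDeriv μ =ᵐ[μ] f.law.rnDeriv μ :=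
      Measure.rnDeriv_mul_rnDeriv (hf.trans (absolutelyContinuous_toFinite μ))
    have h3 : f.law.rnDeriv μ =ᵐ[μ] fun y => (f y : ℝ≥0∞) :=
      Measure.rnDeriv_withDensity μ f.measurable.coe_nnreal_ennreal
    filter_upwards [h1, h2, h3] with y e1 e2 e3
    simp only [Pi.mul_apply] at e2
    simp only [e1, g, e2, e3, ENNReal.toNNReal_coe]

/-- The Kullback-Leibler divergence `K(f⋆, f) = ∫ log(f⋆ / f) f⋆ dμ`, in `[0, ∞]`. -/
def K (fstar f : Density μ) : ℝ≥0∞ := InformationTheory.klDiv fstar.law f.law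

/-- `V(f⋆, f) = ∫ {log(f⋆ / f)}² f⋆ dμ`, in `[0, ∞]`, where `{log(f⋆ / f)}² = ∞` at the points
with `f = 0`, and `∞ * 0 = 0`. -/
def V (fstar f : Density μ) : ℝ≥0∞ :=
  ∫⁻ y, (if f y = 0 then ∞ else ENNReal.ofReal (Real.log (fstar y / f y : ℝ) ^ 2))
    * (fstar y : ℝ≥0∞) ∂μ

/-- The prior is `ε_n`-thick at `f⋆`, with the constant `C`. -/
structure IsThick (prior : Measure (Density μ)) (fstar : Density μ) (ε : ℕ → ℝ) (C : ℝ) : Prop where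
  pos : ∀ n, 0 < ε n
  tendsto_zero : Tendsto ε atTop (𝓝 0)
  tendsto_atTop : Tendsto (fun n : ℕ => n * ε n ^ 2) atTop atTop
  const_pos : 0 < C
  mass : ∀ᶠ n : ℕ in atTop, ENNReal.ofReal (Real.exp (-(C * n * ε n ^ 2))) ≤
    prior {f | K fstar f ≤ ENNReal.ofReal (ε n ^ 2) ∧ V fstar f ≤ ENNReal.ofReal (ε n ^ 2)}

/-- Condition S (sieve), where `C` is the constant of prior thickness.
The covering number is the minimal number of Hellinger balls of radius `ε_n` with arbitrary
centres in `𝔽`. -/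
def ConditionS (prior : Measure (Density μ)) (ε : ℕ → ℝ) (C : ℝ) : Prop :=
  ∃ S : ℕ → Set (Density μ), (∀ n, MeasurableSet (S n)) ∧
    (∃ r > C + 1, ∃ D > 0, ∀ᶠ n : ℕ in atTop,
      prior (S n)ᶜ ≤ ENNReal.ofReal (D * Real.exp (-(r * n * ε n ^ 2)))) ∧
    (∃ R > 0, ∀ᶠ n : ℕ in atTop,
      ENNReal.log (Metric.externalCoveringNumber (ε n).toNNReal (S n) : ℝ≥0∞)
        ≤ ((R * (n * ε n ^ 2) : ℝ) : EReal))

/-- `A` is a Hellinger ball (open or closed) of radius `δ`. -/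
def IsHellingerBall (δ : ℝ) (A : Set (Density μ)) : Prop :=
  ∃ f₀ : Density μ, A = {f | hellinger f₀ f < δ} ∨ A = {f | hellinger f₀ f ≤ δ}

/-- Condition P (prior summability): `𝒜 n` is a countable covering of
`B_n = {f : H(f⋆, f) > ε_n}` by Hellinger balls of radius `δ_n < ε_n`. -/
def ConditionP (prior : Measure (Density μ)) (fstar : Density μ) (ε : ℕ → ℝ) : Prop :=
  ∃ (δ : ℕ → ℝ) (𝒜 : ℕ → Set (Set (Density μ))),
    (∀ᶠ n in atTop, 0 < δ n ∧ δ n < ε n ∧ (𝒜 n).Countable ∧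
      (∀ A ∈ 𝒜 n, IsHellingerBall (δ n) A) ∧ {f | ε n < hellinger fstar f} ⊆ ⋃₀ 𝒜 n) ∧
    ∃ c > 0, ∃ β > 1, Tendsto (fun n : ℕ =>
      ENNReal.ofReal (Real.exp (-(c * n * ε n ^ 2))) *
        ∑' A : 𝒜 n, prior (A : Set (Density μ)) ^ (1 / β : ℝ))
      atTop (𝓝 0)

/-- The likelihood `∏_{i=1}^n f(Y_i)` computed with the version `p`; the observation `Y_i` is
indexed by `i - 1`. -/
def likelihood (p : Density μ → 𝕐 → ℝ≥0) (n : ℕ) (Y : ℕ → 𝕐) (f : Density μ) : ℝ≥0∞ :=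
  ∏ i ∈ Finset.range n, (p f (Y i) : ℝ≥0∞)

/-- The posterior mass
`Π_n(A) = ∫_A ∏ f(Y_i) Π(df) / ∫_𝔽 ∏ f(Y_i) Π(df)` given `Y_1, …, Y_n`. -/
def posterior (prior : Measure (Density μ)) (p : Density μ → 𝕐 → ℝ≥0) (n : ℕ) (Y : ℕ → 𝕐)
    (A : Set (Density μ)) : ℝ≥0∞ :=
  (∫⁻ f in A, likelihood p n Y f ∂prior) / ∫⁻ f, likelihood p n Y f ∂prior

end Density

end BayesRate

end

/-!
Multiplying numerator and denominator of the posterior by `∏ 1 / f⋆(Y_i)`, which is almost surely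
positive and finite, turns the likelihood into the likelihood ratio `R_n(f) = ∏ f(Y_i) / f⋆(Y_i)`.
Write `u_n = n ε_n²`.

*Denominator.* For a density `f` with `K(f⋆, f) ≤ ε_n²` and `V(f⋆, f) ≤ ε_n²`, Chebyshev's
inequality gives `R_n(f) ≥ e^{-(1 + a) u_n}` up to probability `1 / (a² u_n)`
(`IsVersion.measure_likelihoodRatio_lt_le`). By Fubini and Markov, with probability tending to `1`
this holds for at least half of the prior mass of the neighbourhood, so that prior thickness bounds
the denominator below by `e^{-(C + 1 + a) u_n} / 2` (`IsVersion.measure_evidence_lt_le`).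

*Numerator.* Let `A` be contained in a ball of radius `δ` whose centre has distance at least
`δ + t` from `f⋆`. Hellinger balls are convex (`IsVersion.dist_mixture_le`), so every mixture of
densities from `A` has distance at least `t` from `f⋆`, that is, affinity at most `1 - t² / 2`.
Applied to the prior on `A` reweighted by `R_{n-1}`, this gives by induction on `n` that
`E (∫_A R_n dΠ)^{1/2} ≤ Π(A)^{1/2} (1 - t² / 2)^n`
(`IsVersion.lintegral_sqrt_likelihoodRatio_le`), and Hölder's inequality turns the exponent `1 / 2`
into any `s ∈ (0, 1)`, at the price of a constant in the exponential rate
(`IsVersion.lintegral_rpow_likelihoodRatio_le`).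

*Conclusion.* Both conditions provide a cover of the complement of the `ε_n`-ball around `f⋆` by a
remainder of prior mass `O(e^{-r u_n})`, `r > C + 1`, and countably many sets in `ε_n`-balls with
`∑ Π(A)^s = o(e^{c u_n})` (`IsGoodCover`); here `s = 1 / 2` under condition S and `s = 1 / β` under
condition P. A posterior mass is at most its power with exponent `s`, and the expectation of the
sum of these powers is at most `2 e^{(C + 1 + a) u_n} e^{-κ (M - 2)² u_n} ∑ Π(A)^s` with
`κ = min s (1 - s)`, which tends to `0` once `M` is large (`IsGoodCover.tendsto_posterior`).
-/

noncomputable section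

namespace BayesRate

/-! ### Affinities and mixtures of densities -/

section Affinity

variable {𝕐 : Type*} [MeasurableSpace 𝕐] {μ : Measure 𝕐}

theorem dist_sq_eq (f g : Density μ) :
    dist f g ^ 2 = 2 - 2 * ∫ y, √(f y : ℝ) * √(g y : ℝ) ∂μ := by
  have one (f : Density μ) : ∫ y, √(f y : ℝ) ^ 2 ∂μ = 1 := by
    simp only [Real.sq_sqrt (NNReal.coe_nonneg _)]
    rw [integral_eq_lintegral_of_nonneg_ae (ae_of_all _ fun y => NNReal.coe_nonneg _)
      f.measurable.coe_nnreal_real.aestronglyMeasurable]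
    simp only [ENNReal.ofReal_coe_nnreal]
    rw [f.2, ENNReal.toReal_one]
  have expand {a b : 𝕐 → ℝ} (ha : MemLp a 2 μ) (hb : MemLp b 2 μ) :
      ∫ y, (a y - b y) ^ 2 ∂μ
        = ∫ y, a y ^ 2 ∂μ + ∫ y, b y ^ 2 ∂μ - 2 * ∫ y, a y * b y ∂μ := by
    have hadd : Integrable (fun y => a y ^ 2 + b y ^ 2) μ := ha.integrable_sq.add hb.integrable_sq
    have hmul : Integrable (fun y => 2 * (a y * b y)) μ := (ha.integrable_mul hb).const_mul 2
    rw [← integral_const_mul, ← integral_add ha.integrable_sq hb.integrable_sq,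
      ← integral_sub hadd hmul]
    exact integral_congr_ae (ae_of_all _ fun y => by simp only []; ring)
  rw [dist_eq_hellinger, hellinger, Real.sq_sqrt (integral_nonneg fun y => sq_nonneg _),
    expand (memLp_sqrt f) (memLp_sqrt g), one, one]
  norm_num

theorem dist_sq_le_two (f g : Density μ) : dist f g ^ 2 ≤ 2 := by
  rw [dist_sq_eq]
  have : 0 ≤ ∫ y, √(f y : ℝ) * √(g y : ℝ) ∂μ := integral_nonneg fun y => by positivity
  linarith

theorem lintegral_affinity (f g : Density μ) :
    ∫⁻ y, (f y : ℝ≥0∞) ^ (1 / 2 : ℝ) * (g y : ℝ≥0∞) ^ (1 / 2 : ℝ) ∂μ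
      = ENNReal.ofReal (1 - dist f g ^ 2 / 2) := by
  have hfg : Integrable (fun y => √(f y : ℝ) * √(g y : ℝ)) μ :=
    (memLp_sqrt f).integrable_mul (memLp_sqrt g)
  have : 1 - dist f g ^ 2 / 2 = ∫ y, √(f y : ℝ) * √(g y : ℝ) ∂μ := by rw [dist_sq_eq]; ring
  rw [this, ofReal_integral_eq_lintegral_ofReal hfg (ae_of_all _ fun y => by positivity)]
  refine lintegral_congr fun y => ?_
  rw [ENNReal.ofReal_mul (Real.sqrt_nonneg _), Real.sqrt_eq_rpow, Real.sqrt_eq_rpow,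
    ← ENNReal.ofReal_rpow_of_nonneg (NNReal.coe_nonneg _) (by norm_num),
    ← ENNReal.ofReal_rpow_of_nonneg (NNReal.coe_nonneg _) (by norm_num),
    ENNReal.ofReal_coe_nnreal, ENNReal.ofReal_coe_nnreal]

/-- Jensen's inequality for the concave function `x ↦ x ^ s`, `0 ≤ s ≤ 1`. -/
theorem lintegral_rpow_le_rpow_lintegral {α : Type*} [MeasurableSpace α] {ν : Measure α}
    [IsProbabilityMeasure ν] {X : α → ℝ≥0∞} (hX : AEMeasurable X ν) {s : ℝ} (hs0 : 0 ≤ s)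
    (hs1 : s ≤ 1) : ∫⁻ x, X x ^ s ∂ν ≤ (∫⁻ x, X x ∂ν) ^ s := by
  simpa using ENNReal.lintegral_mul_norm_pow_le hX (aemeasurable_const (b := (1 : ℝ≥0∞))) hs0
    (sub_nonneg.2 hs1) (add_sub_cancel s 1)

variable {p : Density μ → 𝕐 → ℝ≥0}

theorem IsVersion.lintegral_eq_one (hp : IsVersion p) (f : Density μ) :
    ∫⁻ y, (p f y : ℝ≥0∞) ∂μ = 1 := by
  rw [← f.2]
  refine lintegral_congr_ae ?_
  filter_upwards [hp.ae_eq f] with y hy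
  rw [hy]

theorem IsVersion.measurable_ennreal (hp : IsVersion p) :
    Measurable fun x : Density μ × 𝕐 => (p x.1 x.2 : ℝ≥0∞) :=
  hp.measurable.coe_nnreal_ennreal

variable [SigmaFinite μ]

/-- Mixing the densities over a probability measure gives a density. -/
theorem IsVersion.exists_mixture (hp : IsVersion p) (ν : Measure (Density μ))
    [IsProbabilityMeasure ν] :
    ∃ g : Density μ, (fun y => (g y : ℝ≥0∞)) =ᵐ[μ] fun y => ∫⁻ f, (p f y : ℝ≥0∞) ∂ν := by
  set m : 𝕐 → ℝ≥0∞ := fun y => ∫⁻ f, (p f y : ℝ≥0∞) ∂ν with hm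
  have hmm : Measurable m := hp.measurable_ennreal.lintegral_prod_left'
  have hm1 : ∫⁻ y, m y ∂μ = 1 := by
    rw [hm, ← lintegral_lintegral_swap (f := fun f y => (p f y : ℝ≥0∞))
      hp.measurable_ennreal.aemeasurable]
    simp [hp.lintegral_eq_one]
  have hfin : ∀ᵐ y ∂μ, m y < ∞ := ae_lt_top hmm (by simp [hm1])
  let g : 𝕐 →ₘ[μ] ℝ≥0 :=
    AEEqFun.mk (fun y => (m y).toNNReal) hmm.ennreal_toNNReal.aestronglyMeasurable
  have hg : (fun y => (g y : ℝ≥0∞)) =ᵐ[μ] m := by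
    filter_upwards [AEEqFun.coeFn_mk (fun y => (m y).toNNReal)
      hmm.ennreal_toNNReal.aestronglyMeasurable, hfin] with y hy hy'
    rw [hy, ENNReal.coe_toNNReal hy'.ne]
  exact ⟨⟨g, by rw [lintegral_congr_ae hg, hm1]⟩, hg⟩

/-- Hellinger balls are convex: a mixture of densities from a ball stays in that ball. The reason
is that `√` is concave, so that affinities can only grow under mixing. -/
theorem IsVersion.dist_mixture_le (hp : IsVersion p) {ν : Measure (Density μ)}
    [IsProbabilityMeasure ν] {g f₀ : Density μ}
    (hg : (fun y => (g y : ℝ≥0∞)) =ᵐ[μ] fun y => ∫⁻ f, (p f y : ℝ≥0∞) ∂ν)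
    {δ : ℝ} (hδ : 0 ≤ δ) (hν : ∀ᵐ f ∂ν, dist f f₀ ≤ δ) : dist g f₀ ≤ δ := by
  have hpm := hp.measurable_ennreal
  have hf₀ : Measurable fun y => (f₀ y : ℝ≥0∞) ^ (1 / 2 : ℝ) :=
    f₀.measurable.coe_nnreal_ennreal.pow_const _
  have key : ENNReal.ofReal (1 - δ ^ 2 / 2) ≤ ENNReal.ofReal (1 - dist g f₀ ^ 2 / 2) := calc
    ENNReal.ofReal (1 - δ ^ 2 / 2)
      = ∫⁻ _, ENNReal.ofReal (1 - δ ^ 2 / 2) ∂ν := by simp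
    _ ≤ ∫⁻ f, ∫⁻ y, (p f y : ℝ≥0∞) ^ (1 / 2 : ℝ) * (f₀ y : ℝ≥0∞) ^ (1 / 2 : ℝ) ∂μ ∂ν := by
        refine lintegral_mono_ae ?_
        filter_upwards [hν] with f hf
        have : ∫⁻ y, (p f y : ℝ≥0∞) ^ (1 / 2 : ℝ) * (f₀ y : ℝ≥0∞) ^ (1 / 2 : ℝ) ∂μ
            = ENNReal.ofReal (1 - dist f f₀ ^ 2 / 2) := by
          rw [← lintegral_affinity]
          refine lintegral_congr_ae ?_
          filter_upwards [hp.ae_eq f] with y hy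
          rw [hy]
        rw [this]
        gcongr
    _ = ∫⁻ y, ∫⁻ f, (p f y : ℝ≥0∞) ^ (1 / 2 : ℝ) * (f₀ y : ℝ≥0∞) ^ (1 / 2 : ℝ) ∂ν ∂μ :=
        lintegral_lintegral_swap
          ((hpm.pow_const _).mul (hf₀.comp measurable_snd)).aemeasurable
    _ = ∫⁻ y, (∫⁻ f, (p f y : ℝ≥0∞) ^ (1 / 2 : ℝ) ∂ν) * (f₀ y : ℝ≥0∞) ^ (1 / 2 : ℝ) ∂μ := by
        refine lintegral_congr fun y => ?_
        exact lintegral_mul_const _ ((hpm.comp measurable_prodMk_right).pow_const _)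
    _ ≤ ∫⁻ y, (g y : ℝ≥0∞) ^ (1 / 2 : ℝ) * (f₀ y : ℝ≥0∞) ^ (1 / 2 : ℝ) ∂μ := by
        refine lintegral_mono_ae ?_
        filter_upwards [hg] with y hy
        rw [hy]
        gcongr
        exact lintegral_rpow_le_rpow_lintegral
          (hpm.comp measurable_prodMk_right).aemeasurable (by norm_num) (by norm_num)
    _ = ENNReal.ofReal (1 - dist g f₀ ^ 2 / 2) := lintegral_affinity g f₀
  have h2 := dist_sq_le_two g f₀
  rw [ENNReal.ofReal_le_ofReal_iff (by linarith)] at key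
  exact abs_le_of_sq_le_sq' (by linarith) hδ |>.2

/-- The affinity between `f⋆` and a mixture of densities from a ball whose centre is far from
`f⋆`. The mixing measure is not normalized. -/
theorem IsVersion.lintegral_mixture_le (hp : IsVersion p) {ν : Measure (Density μ)}
    [IsFiniteMeasure ν] {f₀ fstar : Density μ} {δ t : ℝ} (hδ : 0 ≤ δ) (ht : 0 ≤ t)
    (hν : ∀ᵐ f ∂ν, dist f f₀ ≤ δ) (hfar : δ + t ≤ dist f₀ fstar) :
    ∫⁻ y, (∫⁻ f, (p f y : ℝ≥0∞) ∂ν) ^ (1 / 2 : ℝ) * (fstar y : ℝ≥0∞) ^ (1 / 2 : ℝ) ∂μ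
      ≤ ν univ ^ (1 / 2 : ℝ) * ENNReal.ofReal (1 - t ^ 2 / 2) := by
  rcases eq_or_ne ν 0 with rfl | h0
  · simp
  have hu0 : ν univ ≠ 0 := by simpa using h0
  have hut : ν univ ≠ ∞ := measure_ne_top _ _
  set ν₁ : Measure (Density μ) := (ν univ)⁻¹ • ν with hν₁
  have : NeZero ν := ⟨h0⟩
  have : IsProbabilityMeasure ν₁ := by rw [hν₁]; infer_instance
  have hνν : ν = ν univ • ν₁ := by
    rw [hν₁, smul_smul, ENNReal.mul_inv_cancel hu0 hut, one_smul]
  obtain ⟨g, hg⟩ := hp.exists_mixture ν₁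
  have hgd : dist g f₀ ≤ δ :=
    hp.dist_mixture_le hg hδ (Measure.ae_smul_measure hν _)
  have htg : t ≤ dist g fstar := by
    have := dist_triangle_left f₀ fstar g
    linarith
  calc ∫⁻ y, (∫⁻ f, (p f y : ℝ≥0∞) ∂ν) ^ (1 / 2 : ℝ) * (fstar y : ℝ≥0∞) ^ (1 / 2 : ℝ) ∂μ
      = ∫⁻ y, ν univ ^ (1 / 2 : ℝ) *
          ((g y : ℝ≥0∞) ^ (1 / 2 : ℝ) * (fstar y : ℝ≥0∞) ^ (1 / 2 : ℝ)) ∂μ := by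
        refine lintegral_congr_ae ?_
        filter_upwards [hg] with y hy
        have : ∫⁻ f, (p f y : ℝ≥0∞) ∂ν = ν univ * ∫⁻ f, (p f y : ℝ≥0∞) ∂ν₁ := by
          conv_lhs => rw [hνν, lintegral_smul_measure]
          rfl
        rw [this, hy, ENNReal.mul_rpow_of_nonneg _ _ (by norm_num), mul_assoc]
    _ = ν univ ^ (1 / 2 : ℝ) * ENNReal.ofReal (1 - dist g fstar ^ 2 / 2) := by
        rw [lintegral_const_mul' _ _ (ENNReal.rpow_ne_top_of_nonneg (by norm_num) hut),
          lintegral_affinity]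
    _ ≤ _ := by gcongr

end Affinity

/-! ### The likelihood ratio and its fractional moments -/

section LikelihoodRatio

variable {𝕐 : Type*} [MeasurableSpace 𝕐] {μ : Measure 𝕐}

/-- The likelihood ratio `∏_{i < n} f(Y_i) / f⋆(Y_i)`, with values in `[0, ∞]`. The conventions
`0 / 0 = 0` and `a / 0 = ∞` do not matter: almost surely `f⋆(Y_i) ≠ 0` for all `i`. -/
def likelihoodRatio (p : Density μ → 𝕐 → ℝ≥0) (fstar : Density μ) (n : ℕ) (Y : ℕ → 𝕐)
    (f : Density μ) : ℝ≥0∞ :=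
  ∏ i ∈ Finset.range n, (p f (Y i) : ℝ≥0∞) / (fstar (Y i) : ℝ≥0∞)

instance (f : Density μ) : IsProbabilityMeasure f.law := ⟨law_univ f⟩

theorem lintegral_law (fstar : Density μ) {h : 𝕐 → ℝ≥0∞} (hh : Measurable h) :
    ∫⁻ y, h y ∂fstar.law = ∫⁻ y, (fstar y : ℝ≥0∞) * h y ∂μ :=
  lintegral_withDensity_eq_lintegral_mul μ fstar.measurable.coe_nnreal_ennreal hh

theorem ae_law_pos (fstar : Density μ) : ∀ᵐ y ∂fstar.law, fstar y ≠ 0 := by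
  rw [Density.law, ae_withDensity_iff fstar.measurable.coe_nnreal_ennreal]
  exact ae_of_all _ fun y hy => by simpa using hy

variable {p : Density μ → 𝕐 → ℝ≥0} {fstar : Density μ}

theorem IsVersion.measurable_ratio (hp : IsVersion p) :
    Measurable fun x : Density μ × 𝕐 => (p x.1 x.2 : ℝ≥0∞) / (fstar x.2 : ℝ≥0∞) :=
  hp.measurable_ennreal.div (fstar.measurable.coe_nnreal_ennreal.comp measurable_snd)

theorem IsVersion.measurable_likelihoodRatio (hp : IsVersion p) {Ω : Type*} [MeasurableSpace Ω]
    {Y : ℕ → Ω → 𝕐} (hYm : ∀ i, Measurable (Y i)) (n : ℕ) :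
    Measurable fun x : Ω × Density μ => likelihoodRatio p fstar n (fun i => Y i x.1) x.2 :=
  Finset.measurable_prod _ fun i _ =>
    hp.measurable_ratio.comp (measurable_snd.prodMk ((hYm i).comp measurable_fst))

theorem IsVersion.lintegral_ratio_le_one (hp : IsVersion p) (f : Density μ) :
    ∫⁻ y, (p f y : ℝ≥0∞) / (fstar y : ℝ≥0∞) ∂fstar.law ≤ 1 := by
  refine (lintegral_law fstar (hp.measurable_ratio.comp measurable_prodMk_left)).trans_le ?_
  exact (lintegral_mono fun y => ENNReal.mul_div_le).trans_eq (hp.lintegral_eq_one f)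

theorem IsVersion.lintegral_lintegral_ratio_le (hp : IsVersion p) (ν : Measure (Density μ))
    [SFinite ν] :
    ∫⁻ y, ∫⁻ f, (p f y : ℝ≥0∞) / (fstar y : ℝ≥0∞) ∂ν ∂fstar.law ≤ ν univ := by
  rw [← lintegral_lintegral_swap (f := fun f y => (p f y : ℝ≥0∞) / (fstar y : ℝ≥0∞))
    hp.measurable_ratio.aemeasurable]
  calc _ ≤ ∫⁻ _, 1 ∂ν := lintegral_mono fun f => hp.lintegral_ratio_le_one f
    _ = ν univ := lintegral_one

theorem IsVersion.lintegral_sqrt_ratio_le [SigmaFinite μ] (hp : IsVersion p)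
    {ν : Measure (Density μ)} [IsFiniteMeasure ν] {f₀ : Density μ} {δ t : ℝ} (hδ : 0 ≤ δ)
    (ht : 0 ≤ t) (hν : ∀ᵐ f ∂ν, dist f f₀ ≤ δ) (hfar : δ + t ≤ dist f₀ fstar) :
    ∫⁻ y, (∫⁻ f, (p f y : ℝ≥0∞) / (fstar y : ℝ≥0∞) ∂ν) ^ (1 / 2 : ℝ) ∂fstar.law
      ≤ ν univ ^ (1 / 2 : ℝ) * ENNReal.ofReal (1 - t ^ 2 / 2) := by
  refine le_trans ?_ (hp.lintegral_mixture_le hδ ht hν hfar)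
  rw [lintegral_law _ (hp.measurable_ratio.lintegral_prod_left'.pow_const _)]
  refine lintegral_mono fun y => ?_
  rcases eq_or_ne (fstar y) 0 with h0 | h0
  · simp [h0]
  have h0' : (fstar y : ℝ≥0∞) ≠ 0 := by simpa using h0
  have hm : ∫⁻ f, (p f y : ℝ≥0∞) / (fstar y : ℝ≥0∞) ∂ν
      = (∫⁻ f, (p f y : ℝ≥0∞) ∂ν) * (fstar y : ℝ≥0∞)⁻¹ :=
    lintegral_mul_const _ (hp.measurable_ennreal.comp measurable_prodMk_right)
  have hs : (fstar y : ℝ≥0∞) * ((fstar y : ℝ≥0∞)⁻¹) ^ (1 / 2 : ℝ)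
      = (fstar y : ℝ≥0∞) ^ (1 / 2 : ℝ) := by
    rw [ENNReal.inv_rpow, ← ENNReal.rpow_neg]
    nth_rw 1 [← ENNReal.rpow_one (fstar y : ℝ≥0∞)]
    rw [← ENNReal.rpow_add _ _ h0' ENNReal.coe_ne_top]
    norm_num
  have hgoal : (fstar y : ℝ≥0∞) * (∫⁻ f, (p f y : ℝ≥0∞) / (fstar y : ℝ≥0∞) ∂ν) ^ (1 / 2 : ℝ)
      = (∫⁻ f, (p f y : ℝ≥0∞) ∂ν) ^ (1 / 2 : ℝ) * (fstar y : ℝ≥0∞) ^ (1 / 2 : ℝ) := by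
    rw [hm, ENNReal.mul_rpow_of_nonneg _ _ (by norm_num), mul_left_comm, hs]
  exact hgoal.le

variable {Ω : Type*} [MeasurableSpace Ω] {P : Measure Ω} [IsProbabilityMeasure P]
  {Y : ℕ → Ω → 𝕐}

/-- Independence of the past `Y_0, …, Y_{n-1}` and the next observation `Y_n`. -/
theorem lintegral_past_next (hYm : ∀ i, Measurable (Y i)) (hYindep : iIndepFun Y P) (n : ℕ)
    {Φ : (Finset.range n → 𝕐) × 𝕐 → ℝ≥0∞} (hΦ : Measurable Φ) :
    ∫⁻ ω, Φ (fun i => Y i ω, Y n ω) ∂P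
      = ∫⁻ ω, ∫⁻ y, Φ (fun i => Y i ω, y) ∂(P.map (Y n)) ∂P := by
  have hX : Measurable fun ω (i : Finset.range n) => Y i ω := measurable_pi_lambda _ fun i => hYm i
  have hind : IndepFun (fun ω (i : Finset.range n) => Y i ω) (Y n) P := by
    have h := hYindep.indepFun_finset (Finset.range n) {n} (by simp) hYm
    exact h.comp measurable_id (measurable_pi_apply (⟨n, by simp⟩ : ({n} : Finset ℕ)))
  have : IsProbabilityMeasure (P.map (Y n)) := Measure.isProbabilityMeasure_map (hYm n).aemeasurable
  rw [indepFun_iff_map_prod_eq_prod_map_map hX.aemeasurable (hYm n).aemeasurable] at hind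
  rw [← lintegral_map (g := fun ω => ((fun i : Finset.range n => Y i ω), Y n ω)) hΦ
    (hX.prodMk (hYm n)), hind, lintegral_prod _ hΦ.aemeasurable,
    lintegral_map hΦ.lintegral_prod_right' hX]

theorem IsVersion.lintegral_likelihoodRatio_succ (hp : IsVersion p)
    (hYm : ∀ i, Measurable (Y i)) (hYindep : iIndepFun Y P) (hYlaw : ∀ i, P.map (Y i) = fstar.law)
    (ν : Measure (Density μ)) [SFinite ν] (s : ℝ) (n : ℕ) :
    ∫⁻ ω, (∫⁻ f, likelihoodRatio p fstar (n + 1) (fun i => Y i ω) f ∂ν) ^ s ∂P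
      = ∫⁻ ω, ∫⁻ y, (∫⁻ f, (p f y : ℝ≥0∞) / (fstar y : ℝ≥0∞)
          ∂(ν.withDensity (likelihoodRatio p fstar n (fun i => Y i ω)))) ^ s ∂fstar.law ∂P := by
  let r : Density μ → 𝕐 → ℝ≥0∞ := fun f y => (p f y : ℝ≥0∞) / (fstar y : ℝ≥0∞)
  have hr : Measurable (Function.uncurry r) := hp.measurable_ratio
  let G : ((Finset.range n → 𝕐) × 𝕐) × Density μ → ℝ≥0∞ :=
    fun x => (∏ i : Finset.range n, r x.2 (x.1.1 i)) * r x.2 x.1.2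
  have hG : Measurable G := by
    refine (Finset.measurable_prod _ fun i _ => ?_).mul ?_
    · exact hr.comp (measurable_snd.prodMk
        ((measurable_pi_apply i).comp (measurable_fst.comp measurable_fst)))
    · exact hr.comp (measurable_snd.prodMk (measurable_snd.comp measurable_fst))
  have hΦ : Measurable fun x => (∫⁻ f, G (x, f) ∂ν) ^ s := hG.lintegral_prod_right'.pow_const _
  have hprod (ω : Ω) (f : Density μ) : ∏ i : Finset.range n, r f (Y i ω)
      = likelihoodRatio p fstar n (fun i => Y i ω) f :=
    Finset.prod_coe_sort (Finset.range n) fun i => r f (Y i ω)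
  calc ∫⁻ ω, (∫⁻ f, likelihoodRatio p fstar (n + 1) (fun i => Y i ω) f ∂ν) ^ s ∂P
      = ∫⁻ ω, (∫⁻ f, G ((fun i => Y i ω, Y n ω), f) ∂ν) ^ s ∂P := by
        refine lintegral_congr fun ω => ?_
        congr 1
        refine lintegral_congr fun f => ?_
        simp only [G, hprod]
        exact Finset.prod_range_succ _ n
    _ = ∫⁻ ω, ∫⁻ y, (∫⁻ f, G ((fun i => Y i ω, y), f) ∂ν) ^ s ∂fstar.law ∂P := by
        rw [← hYlaw n]
        exact lintegral_past_next hYm hYindep n hΦ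
    _ = _ := by
        refine lintegral_congr fun ω => lintegral_congr fun y => ?_
        congr 1
        refine Eq.trans ?_ (lintegral_withDensity_eq_lintegral_mul ν
          ((hp.measurable_likelihoodRatio hYm n).comp measurable_prodMk_left)
          (hp.measurable_ratio.comp measurable_prodMk_right)).symm
        refine lintegral_congr fun f => ?_
        simp only [G, hprod]
        rfl

theorem IsVersion.lintegral_likelihoodRatio_le (hp : IsVersion p)
    (hYm : ∀ i, Measurable (Y i)) (hYindep : iIndepFun Y P) (hYlaw : ∀ i, P.map (Y i) = fstar.law)
    (ν : Measure (Density μ)) [SFinite ν] (n : ℕ) :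
    ∫⁻ ω, ∫⁻ f, likelihoodRatio p fstar n (fun i => Y i ω) f ∂ν ∂P ≤ ν univ := by
  induction n with
  | zero => simp [likelihoodRatio]
  | succ n ih =>
    have h := hp.lintegral_likelihoodRatio_succ hYm hYindep hYlaw ν 1 n
    simp only [ENNReal.rpow_one] at h
    rw [h]
    refine le_trans (lintegral_mono fun ω => ?_) ih
    refine (hp.lintegral_lintegral_ratio_le _).trans_eq ?_
    rw [withDensity_apply _ MeasurableSet.univ, Measure.restrict_univ]

/-- The square root of the likelihood ratio, averaged over densities from a ball that is far from
`f⋆`, has exponentially small expectation. Conditionally on `Y_0, …, Y_{n-1}`, the next factor is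
an affinity with a mixture over the same ball, for the mixing measure reweighted by the likelihood
ratio so far, so that each observation contributes a factor `1 - t² / 2`. -/
theorem IsVersion.lintegral_sqrt_likelihoodRatio_le [SigmaFinite μ] (hp : IsVersion p)
    (hYm : ∀ i, Measurable (Y i)) (hYindep : iIndepFun Y P) (hYlaw : ∀ i, P.map (Y i) = fstar.law)
    {ν : Measure (Density μ)} [IsFiniteMeasure ν] {f₀ : Density μ} {δ t : ℝ} (hδ : 0 ≤ δ)
    (ht : 0 ≤ t) (hν : ∀ᵐ f ∂ν, dist f f₀ ≤ δ) (hfar : δ + t ≤ dist f₀ fstar) (n : ℕ) :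
    ∫⁻ ω, (∫⁻ f, likelihoodRatio p fstar n (fun i => Y i ω) f ∂ν) ^ (1 / 2 : ℝ) ∂P
      ≤ ν univ ^ (1 / 2 : ℝ) * ENNReal.ofReal (1 - t ^ 2 / 2) ^ n := by
  induction n with
  | zero => simp [likelihoodRatio]
  | succ n ih =>
    rw [hp.lintegral_likelihoodRatio_succ hYm hYindep hYlaw, pow_succ, ← mul_assoc]
    have hmeas : Measurable fun ω =>
        ∫⁻ f, likelihoodRatio p fstar n (fun i => Y i ω) f ∂ν :=
      (hp.measurable_likelihoodRatio hYm n).lintegral_prod_right'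
    have hfin : ∀ᵐ ω ∂P, ∫⁻ f, likelihoodRatio p fstar n (fun i => Y i ω) f ∂ν < ∞ :=
      ae_lt_top hmeas (ne_top_of_le_ne_top (measure_ne_top ν univ)
        (hp.lintegral_likelihoodRatio_le hYm hYindep hYlaw ν n))
    calc _ ≤ ∫⁻ ω, (∫⁻ f, likelihoodRatio p fstar n (fun i => Y i ω) f ∂ν) ^ (1 / 2 : ℝ)
            * ENNReal.ofReal (1 - t ^ 2 / 2) ∂P := by
          refine lintegral_mono_ae ?_
          filter_upwards [hfin] with ω hω
          have : IsFiniteMeasure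
              (ν.withDensity (likelihoodRatio p fstar n (fun i => Y i ω))) :=
            isFiniteMeasure_withDensity hω.ne
          refine (hp.lintegral_sqrt_ratio_le hδ ht
            ((withDensity_absolutelyContinuous ν _).ae_le hν) hfar).trans_eq ?_
          rw [withDensity_apply _ MeasurableSet.univ, Measure.restrict_univ]
      _ ≤ _ := by
          rw [lintegral_mul_const _ (hmeas.pow_const _)]
          gcongr

/-- Fractional moments of exponent `s`, by interpolation between the exponents `0`, `1 / 2`
and `1`. -/
theorem IsVersion.lintegral_rpow_likelihoodRatio_le [SigmaFinite μ] (hp : IsVersion p)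
    (hYm : ∀ i, Measurable (Y i)) (hYindep : iIndepFun Y P) (hYlaw : ∀ i, P.map (Y i) = fstar.law)
    {ν : Measure (Density μ)} [IsFiniteMeasure ν] {f₀ : Density μ} {δ t : ℝ} (hδ : 0 ≤ δ)
    (ht : 0 ≤ t) (hν : ∀ᵐ f ∂ν, dist f f₀ ≤ δ) (hfar : δ + t ≤ dist f₀ fstar) (n : ℕ)
    {s : ℝ} (hs0 : 0 ≤ s) (hs1 : s ≤ 1) :
    ∫⁻ ω, (∫⁻ f, likelihoodRatio p fstar n (fun i => Y i ω) f ∂ν) ^ s ∂P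
      ≤ ν univ ^ s * ENNReal.ofReal (Real.exp (-(min s (1 - s) * n * t ^ 2))) := by
  set X : Ω → ℝ≥0∞ := fun ω => ∫⁻ f, likelihoodRatio p fstar n (fun i => Y i ω) f ∂ν with hX
  have hmeas : Measurable X := (hp.measurable_likelihoodRatio hYm n).lintegral_prod_right'
  have h1 : ∫⁻ ω, X ω ∂P ≤ ν univ := hp.lintegral_likelihoodRatio_le hYm hYindep hYlaw ν n
  have h2 : ∫⁻ ω, X ω ^ (1 / 2 : ℝ) ∂P
      ≤ ν univ ^ (1 / 2 : ℝ) * ENNReal.ofReal (Real.exp (-(n * t ^ 2 / 2))) := by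
    refine (hp.lintegral_sqrt_likelihoodRatio_le hYm hYindep hYlaw hδ ht hν hfar n).trans ?_
    gcongr
    have : Real.exp (-(n * t ^ 2 / 2)) = Real.exp (-(t ^ 2 / 2)) ^ n := by
      rw [← Real.exp_nat_mul]; ring_nf
    rw [this, ENNReal.ofReal_pow (Real.exp_nonneg _)]
    gcongr
    linarith [Real.add_one_le_exp (-(t ^ 2 / 2))]
  have hexp (q : ℝ) (hq : 0 ≤ q) : ENNReal.ofReal (Real.exp (-(n * t ^ 2 / 2))) ^ (2 * q)
      = ENNReal.ofReal (Real.exp (-(q * n * t ^ 2))) := by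
    rw [ENNReal.ofReal_rpow_of_nonneg (Real.exp_nonneg _) (by linarith), ← Real.exp_mul]
    ring_nf
  rcases le_total s (1 / 2) with hs | hs
  · rw [min_eq_left (by linarith)]
    calc ∫⁻ ω, X ω ^ s ∂P = ∫⁻ ω, (X ω ^ (1 / 2 : ℝ)) ^ (2 * s) ∂P := by
          refine lintegral_congr fun ω => ?_
          rw [← ENNReal.rpow_mul]; ring_nf
      _ ≤ (∫⁻ ω, X ω ^ (1 / 2 : ℝ) ∂P) ^ (2 * s) :=
          lintegral_rpow_le_rpow_lintegral (hmeas.pow_const _).aemeasurable (by linarith)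
            (by linarith)
      _ ≤ (ν univ ^ (1 / 2 : ℝ) * ENNReal.ofReal (Real.exp (-(n * t ^ 2 / 2)))) ^ (2 * s) := by
          gcongr
      _ = _ := by
          rw [ENNReal.mul_rpow_of_nonneg _ _ (by linarith), hexp s hs0, ← ENNReal.rpow_mul]
          ring_nf
  · rw [min_eq_right (by linarith)]
    calc ∫⁻ ω, X ω ^ s ∂P
        = ∫⁻ ω, (X ω ^ (1 / 2 : ℝ)) ^ (2 * (1 - s)) * X ω ^ (2 * s - 1) ∂P := by
          refine lintegral_congr fun ω => ?_
          rw [← ENNReal.rpow_mul, ← ENNReal.rpow_add_of_nonneg _ _ (by linarith) (by linarith)]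
          ring_nf
      _ ≤ (∫⁻ ω, X ω ^ (1 / 2 : ℝ) ∂P) ^ (2 * (1 - s)) * (∫⁻ ω, X ω ∂P) ^ (2 * s - 1) :=
          ENNReal.lintegral_mul_norm_pow_le (hmeas.pow_const _).aemeasurable hmeas.aemeasurable
            (by linarith) (by linarith) (by ring)
      _ ≤ (ν univ ^ (1 / 2 : ℝ) * ENNReal.ofReal (Real.exp (-(n * t ^ 2 / 2)))) ^ (2 * (1 - s))
            * ν univ ^ (2 * s - 1) := by
          gcongr
          linarith
      _ = _ := by
          rw [ENNReal.mul_rpow_of_nonneg _ _ (by linarith), hexp (1 - s) (by linarith),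
            ← ENNReal.rpow_mul, mul_right_comm,
            ← ENNReal.rpow_add_of_nonneg _ _ (by linarith) (by linarith)]
          ring_nf

end LikelihoodRatio

/-! ### Densities close to `f⋆` in Kullback-Leibler divergence -/

section KullbackLeibler

variable {𝕐 : Type*} [MeasurableSpace 𝕐] {μ : Measure 𝕐}
  {p : Density μ → 𝕐 → ℝ≥0} {fstar f : Density μ}

theorem absolutelyContinuous_of_K_ne_top (h : K fstar f ≠ ∞) : fstar.law ≪ f.law :=
  (InformationTheory.klDiv_ne_top_iff.1 h).1

theorem IsVersion.ae_law_eq (hp : IsVersion p) : ∀ᵐ y ∂fstar.law, p f y = f y :=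
  (withDensity_absolutelyContinuous μ _).ae_le (hp.ae_eq f)

theorem llr_law_ae_eq [SigmaFinite μ] (hac : fstar.law ≪ f.law) :
    llr fstar.law f.law =ᵐ[fstar.law] fun y => Real.log (fstar y / f y : ℝ) := by
  have hμ (g : Density μ) : g.law ≪ μ := withDensity_absolutelyContinuous μ _
  have hd (g : Density μ) : g.law.rnDeriv μ =ᵐ[μ] fun y => (g y : ℝ≥0∞) :=
    Measure.rnDeriv_withDensity μ g.measurable.coe_nnreal_ennreal
  have h : fstar.law.rnDeriv f.law * f.law.rnDeriv μ =ᵐ[μ] fstar.law.rnDeriv μ :=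
    Measure.rnDeriv_mul_rnDeriv hac
  filter_upwards [(hμ fstar).ae_le h, (hμ fstar).ae_le (hd f), (hμ fstar).ae_le (hd fstar),
    hac.ae_le (ae_law_pos f)] with y h1 h2 h3 h4
  rw [Pi.mul_apply, h2, h3] at h1
  have h4' : ((f y : ℝ≥0) : ℝ) ≠ 0 := NNReal.coe_ne_zero.2 h4
  rw [llr]
  congr 1
  rw [eq_div_iff h4']
  simpa using congrArg ENNReal.toReal h1

theorem memLp_log_ratio (hV : V fstar f ≠ ∞) :
    MemLp (fun y => Real.log (fstar y / f y : ℝ)) 2 fstar.law ∧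
      ENNReal.ofReal (∫ y, Real.log (fstar y / f y : ℝ) ^ 2 ∂fstar.law) ≤ V fstar f := by
  have hm : Measurable fun y => Real.log (fstar y / f y : ℝ) :=
    (fstar.measurable.coe_nnreal_real.div f.measurable.coe_nnreal_real).log
  have hle : ∫⁻ y, ENNReal.ofReal (Real.log (fstar y / f y : ℝ) ^ 2) ∂fstar.law ≤ V fstar f := by
    refine (lintegral_law fstar (hm.pow_const 2).ennreal_ofReal).trans_le
      (lintegral_mono fun y => ?_)
    beta_reduce
    rw [mul_comm]
    gcongr
    split_ifs
    · exact le_top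
    · exact le_rfl
  have hint : Integrable (fun y => Real.log (fstar y / f y : ℝ) ^ 2) fstar.law := by
    refine ⟨(hm.pow_const 2).aestronglyMeasurable, ?_⟩
    rw [hasFiniteIntegral_iff_ofReal (ae_of_all _ fun y => sq_nonneg _)]
    exact hle.trans_lt hV.lt_top
  refine ⟨(memLp_two_iff_integrable_sq hm.aestronglyMeasurable).2 hint, ?_⟩
  rw [ofReal_integral_eq_lintegral_ofReal hint (ae_of_all _ fun y => sq_nonneg _)]
  exact hle

theorem integral_log_ratio_le [SigmaFinite μ] {e : ℝ} (he : 0 ≤ e)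
    (hK : K fstar f ≤ ENNReal.ofReal e) :
    ∫ y, Real.log (fstar y / f y : ℝ) ∂fstar.law ≤ e := by
  have hne : K fstar f ≠ ∞ := ne_top_of_le_ne_top ENNReal.ofReal_ne_top hK
  obtain ⟨hac, hint⟩ := InformationTheory.klDiv_ne_top_iff.1 hne
  rw [← integral_congr_ae (llr_law_ae_eq hac)]
  rw [K, InformationTheory.klDiv_of_ac_of_integrable hac hint,
    ENNReal.ofReal_le_ofReal_iff he] at hK
  simpa using hK

variable {Ω : Type*} [MeasurableSpace Ω] {P : Measure Ω} {Y : ℕ → Ω → 𝕐}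

theorem ae_comp_of_law (hYm : ∀ i, Measurable (Y i)) (hYlaw : ∀ i, P.map (Y i) = fstar.law)
    {q : 𝕐 → Prop} (hq : ∀ᵐ y ∂fstar.law, q y) : ∀ᵐ ω ∂P, ∀ i, q (Y i ω) := by
  refine ae_all_iff.2 fun i => ?_
  rw [← hYlaw i] at hq
  exact ae_of_ae_map (hYm i).aemeasurable hq

theorem IsVersion.likelihoodRatio_ae_eq (hp : IsVersion p) (hYm : ∀ i, Measurable (Y i))
    (hYlaw : ∀ i, P.map (Y i) = fstar.law) (hac : fstar.law ≪ f.law) (n : ℕ) :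
    ∀ᵐ ω ∂P, likelihoodRatio p fstar n (fun i => Y i ω) f = ENNReal.ofReal
      (Real.exp (-∑ i ∈ Finset.range n, Real.log (fstar (Y i ω) / f (Y i ω) : ℝ))) := by
  filter_upwards [ae_comp_of_law hYm hYlaw (hp.ae_law_eq (f := f)),
    ae_comp_of_law hYm hYlaw (ae_law_pos fstar),
    ae_comp_of_law hYm hYlaw (hac.ae_le (ae_law_pos f))] with ω h1 h2 h3
  rw [← Finset.sum_neg_distrib, Real.exp_sum,
    ENNReal.ofReal_prod_of_nonneg fun i _ => (Real.exp_pos _).le, likelihoodRatio]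
  refine Finset.prod_congr rfl fun i _ => ?_
  have hs : (0 : ℝ) < fstar (Y i ω) := NNReal.coe_pos.2 (pos_iff_ne_zero.2 (h2 i))
  have hf : (0 : ℝ) < f (Y i ω) := NNReal.coe_pos.2 (pos_iff_ne_zero.2 (h3 i))
  rw [Real.exp_neg, Real.exp_log (div_pos hs hf), inv_div, ENNReal.ofReal_div_of_pos hs,
    ENNReal.ofReal_coe_nnreal, ENNReal.ofReal_coe_nnreal, h1 i]

variable [IsProbabilityMeasure P]

/-- Chebyshev's inequality for the log-likelihood ratio at a density close to `f⋆`. -/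
theorem IsVersion.measure_likelihoodRatio_lt_le [SigmaFinite μ] (hp : IsVersion p)
    (hYm : ∀ i, Measurable (Y i)) (hYindep : iIndepFun Y P) (hYlaw : ∀ i, P.map (Y i) = fstar.law)
    {n : ℕ} (hn : 0 < n) {e a : ℝ} (he : 0 < e) (ha : 0 < a)
    (hK : K fstar f ≤ ENNReal.ofReal e) (hV : V fstar f ≤ ENNReal.ofReal e) :
    P {ω | likelihoodRatio p fstar n (fun i => Y i ω) f
        < ENNReal.ofReal (Real.exp (-((1 + a) * (n * e))))}
      ≤ ENNReal.ofReal (1 / (a ^ 2 * (n * e))) := by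
  set Z : 𝕐 → ℝ := fun y => Real.log (fstar y / f y : ℝ) with hZ
  have hZm : Measurable Z :=
    (fstar.measurable.coe_nnreal_real.div f.measurable.coe_nnreal_real).log
  have hn' : (0 : ℝ) < n := Nat.cast_pos.2 hn
  have hac : fstar.law ≪ f.law :=
    absolutelyContinuous_of_K_ne_top (ne_top_of_le_ne_top ENNReal.ofReal_ne_top hK)
  obtain ⟨hZ2, hZV⟩ := memLp_log_ratio (ne_top_of_le_ne_top ENNReal.ofReal_ne_top hV)
  have hZV' : ∫ y, Z y ^ 2 ∂fstar.law ≤ e :=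
    (ENNReal.ofReal_le_ofReal_iff he.le).1 (hZV.trans hV)
  have hZ1 : ∫ y, Z y ∂fstar.law ≤ e := integral_log_ratio_le he.le hK
  have hW (i : ℕ) : MemLp (Z ∘ Y i) 2 P := by
    have := hZ2
    rw [← hYlaw i] at this
    exact this.comp_of_map (hYm i).aemeasurable
  have hWint {g : 𝕐 → ℝ} (hg : Measurable g) (i : ℕ) :
      ∫ ω, g (Y i ω) ∂P = ∫ y, g y ∂fstar.law := by
    rw [← hYlaw i, integral_map (hYm i).aemeasurable hg.aestronglyMeasurable]
  set S : Ω → ℝ := ∑ i ∈ Finset.range n, Z ∘ Y i with hS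
  have hS2 : MemLp S 2 P := memLp_finsetSum' _ fun i _ => hW i
  have hSmean : P[S] ≤ n * e := by
    have : P[S] = ∑ i ∈ Finset.range n, ∫ ω, Z (Y i ω) ∂P := by
      simp only [hS, Finset.sum_apply]
      exact integral_finsetSum _ fun i _ => (hW i).integrable one_le_two
    rw [this]
    simp only [hWint hZm, Finset.sum_const, Finset.card_range, nsmul_eq_mul]
    gcongr
  have hSvar : variance S P ≤ n * e := by
    rw [hS, IndepFun.variance_sum (fun i _ => hW i)
      fun i _ j _ hij => (hYindep.indepFun hij).comp hZm hZm]
    calc ∑ i ∈ Finset.range n, variance (Z ∘ Y i) P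
        ≤ ∑ i ∈ Finset.range n, e := by
          refine Finset.sum_le_sum fun i _ => ?_
          refine (variance_le_expectation_sq (hW i).1).trans ?_
          have : ∫ ω, Z (Y i ω) ^ 2 ∂P = ∫ y, Z y ^ 2 ∂fstar.law := hWint (hZm.pow_const 2) i
          simpa [this] using hZV'
      _ = n * e := by simp
  have hc : 0 < a * (n * e) := by positivity
  calc P {ω | likelihoodRatio p fstar n (fun i => Y i ω) f
        < ENNReal.ofReal (Real.exp (-((1 + a) * (n * e))))}
      ≤ P {ω | a * (n * e) ≤ |S ω - P[S]|} := by
        refine measure_mono_ae ?_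
        filter_upwards [hp.likelihoodRatio_ae_eq hYm hYlaw hac n] with ω hω hlt
        change likelihoodRatio p fstar n (fun i => Y i ω) f < _ at hlt
        change a * (n * e) ≤ |S ω - P[S]|
        rw [hω, ENNReal.ofReal_lt_ofReal_iff (Real.exp_pos _), Real.exp_lt_exp] at hlt
        have hSω : S ω = ∑ i ∈ Finset.range n, Real.log (fstar (Y i ω) / f (Y i ω) : ℝ) := by
          simp [hS, hZ]
        refine le_trans ?_ (le_abs_self _)
        rw [← hSω] at hlt
        linarith
    _ ≤ ENNReal.ofReal (variance S P / (a * (n * e)) ^ 2) := meas_ge_le_variance_div_sq hS2 hc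
    _ ≤ ENNReal.ofReal (1 / (a ^ 2 * (n * e))) := by
        refine ENNReal.ofReal_le_ofReal ?_
        calc variance S P / (a * (n * e)) ^ 2 ≤ (n * e) / (a * (n * e)) ^ 2 := by gcongr
          _ = 1 / (a ^ 2 * (n * e)) := by field_simp

end KullbackLeibler

/-! ### The denominator of the posterior -/

section Evidence

variable {𝕐 : Type*} [MeasurableSpace 𝕐] {μ : Measure 𝕐}
  {p : Density μ → 𝕐 → ℝ≥0} {fstar : Density μ} {Ω : Type*} [MeasurableSpace Ω] {P : Measure Ω}
  {Y : ℕ → Ω → 𝕐} {prior : Measure (Density μ)}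

/-- If the prior puts mass at least `b` near `f⋆`, then with high probability the averaged
likelihood ratio is not much smaller than `b`. By Chebyshev's inequality, only a small expected
part of the prior mass near `f⋆` sits at densities whose likelihood ratio is small. -/
theorem IsVersion.measure_evidence_lt_le [SigmaFinite μ] [IsProbabilityMeasure P]
    [IsProbabilityMeasure prior]
    (hp : IsVersion p)
    (hYm : ∀ i, Measurable (Y i)) (hYindep : iIndepFun Y P) (hYlaw : ∀ i, P.map (Y i) = fstar.law)
    {n : ℕ} (hn : 0 < n) {e a : ℝ} (he : 0 < e) (ha : 0 < a) {b : ℝ≥0∞} (hb : b ≠ 0)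
    (hmass : b ≤ prior {f | K fstar f ≤ ENNReal.ofReal e ∧ V fstar f ≤ ENNReal.ofReal e}) :
    P {ω | ∫⁻ f, likelihoodRatio p fstar n (fun i => Y i ω) f ∂prior
        < ENNReal.ofReal (Real.exp (-((1 + a) * (n * e)))) * (b / 2)}
      ≤ 2 * ENNReal.ofReal (1 / (a ^ 2 * (n * e))) := by
  set L : ℝ≥0∞ := ENNReal.ofReal (Real.exp (-((1 + a) * (n * e)))) with hL
  set ρ : ℝ≥0∞ := ENNReal.ofReal (1 / (a ^ 2 * (n * e))) with hρ
  let R : Ω → Density μ → ℝ≥0∞ := fun ω => likelihoodRatio p fstar n (fun i => Y i ω)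
  have hR : Measurable (Function.uncurry R) := hp.measurable_likelihoodRatio hYm n
  have hE : MeasurableSet {x : Ω × Density μ | R x.1 x.2 < L} :=
    measurableSet_lt hR measurable_const
  -- The neighbourhood of `f⋆` need not be measurable; this larger set is, and it has the only
  -- property of the neighbourhood that matters.
  let B : Set (Density μ) := {f | P {ω | R ω f < L} ≤ ρ}
  have hB : MeasurableSet B :=
    measurableSet_le (measurable_measure_prodMk_right hE) measurable_const
  have hbB : b ≤ prior B := hmass.trans <| measure_mono fun f hf =>
    hp.measure_likelihoodRatio_lt_le hYm hYindep hYlaw hn he ha hf.1 hf.2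
  set m : ℝ≥0∞ := prior B with hm
  have hm0 : m ≠ 0 := fun h => hb (le_zero_iff.1 (h ▸ hbB))
  have hmt : m ≠ ∞ := measure_ne_top _ _
  let ν : Measure (Density μ) := prior.restrict B
  have hνu : ν univ = m := Measure.restrict_apply_univ B
  let h : Ω → ℝ≥0∞ := fun ω => ν {f | R ω f < L}
  have hh : Measurable h := measurable_measure_prodMk_left hE
  have hint : ∫⁻ ω, h ω ∂P ≤ ρ * m := by
    have h1 : ∫⁻ ω, h ω ∂P = (P.prod ν) {x | R x.1 x.2 < L} := (Measure.prod_apply hE).symm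
    have h2 : (P.prod ν) {x | R x.1 x.2 < L} = ∫⁻ f, P {ω | R ω f < L} ∂ν :=
      Measure.prod_apply_symm hE
    rw [h1, h2, ← hνu, ← lintegral_const]
    exact lintegral_mono_ae (ae_restrict_mem hB)
  calc P {ω | ∫⁻ f, R ω f ∂prior < L * (b / 2)}
      ≤ P {ω | m / 2 ≤ h ω} := by
        refine measure_mono fun ω hω => ?_
        change m / 2 ≤ h ω
        by_contra! hlt
        have hRω : Measurable (R ω) := hR.comp measurable_prodMk_left
        have hgood : m / 2 ≤ ν {f | L ≤ R ω f} := by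
          by_contra! hlt'
          have hsum : m ≤ h ω + ν {f | L ≤ R ω f} := by
            rw [← hνu]
            refine (measure_mono fun f _ => ?_).trans (measure_union_le _ _)
            exact lt_or_ge (R ω f) L
          exact absurd (hsum.trans_lt ((ENNReal.add_lt_add hlt hlt').trans_eq
            (ENNReal.add_halves m))) (lt_irrefl _)
        refine absurd hω.out (not_lt.2 ?_)
        calc L * (b / 2) ≤ L * ν {f | L ≤ R ω f} := by
              gcongr
              exact le_trans (by gcongr) hgood
          _ ≤ ∫⁻ f, R ω f ∂ν := mul_meas_ge_le_lintegral hRω L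
          _ ≤ ∫⁻ f, R ω f ∂prior := setLIntegral_le_lintegral _ _
    _ ≤ (∫⁻ ω, h ω ∂P) / (m / 2) :=
        meas_ge_le_lintegral_div hh.aemeasurable (ENNReal.div_pos hm0 (by simp)).ne'
          (ENNReal.div_ne_top hmt (by simp))
    _ ≤ (ρ * m) / (m / 2) := by gcongr
    _ = 2 * ρ := by
        rw [mul_div_assoc, ENNReal.div_div_cancel hm0 hmt, mul_comm]

theorem IsVersion.ae_evidence_pos [IsProbabilityMeasure P] [IsProbabilityMeasure prior]
    (hp : IsVersion p) (hYm : ∀ i, Measurable (Y i))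
    (hYlaw : ∀ i, P.map (Y i) = fstar.law) (n : ℕ) (hpos : prior {f | fstar.law ≪ f.law} ≠ 0) :
    ∀ᵐ ω ∂P, 0 < ∫⁻ f, likelihoodRatio p fstar n (fun i => Y i ω) f ∂prior := by
  let R : Ω → Density μ → ℝ≥0∞ := fun ω => likelihoodRatio p fstar n (fun i => Y i ω)
  have hR : Measurable (Function.uncurry R) := hp.measurable_likelihoodRatio hYm n
  have hE : MeasurableSet {x : Ω × Density μ | R x.1 x.2 = 0} := hR (measurableSet_singleton 0)
  let B : Set (Density μ) := {f | P {ω | R ω f = 0} = 0}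
  have hB : MeasurableSet B := (measurable_measure_prodMk_right hE) (measurableSet_singleton 0)
  have hB0 : prior B ≠ 0 := fun h => hpos <| measure_mono_null (fun f hf => by
    refine measure_mono_null (t := {ω | ¬ R ω f ≠ 0}) (fun ω hω => not_not.2 hω) ?_
    rw [← ae_iff]
    filter_upwards [hp.likelihoodRatio_ae_eq hYm hYlaw hf n] with ω hω
    change likelihoodRatio p fstar n (fun i => Y i ω) f ≠ 0
    rw [hω]
    exact (ENNReal.ofReal_pos.2 (Real.exp_pos _)).ne') h
  have hae : ∀ᵐ f ∂(prior.restrict B), ∀ᵐ ω ∂P, R ω f ≠ 0 := by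
    filter_upwards [ae_restrict_mem hB] with f hf
    exact measure_mono_null (fun ω hω => not_not.1 hω) (show P {ω | R ω f = 0} = 0 from hf)
  rw [Measure.ae_ae_comm (p := fun f ω => R ω f ≠ 0) (measurable_swap hE.compl)] at hae
  filter_upwards [hae] with ω hω
  refine pos_iff_ne_zero.2 fun h0 => hB0 ?_
  have h1 : R ω =ᵐ[prior.restrict B] 0 := ae_restrict_of_ae
    ((lintegral_eq_zero_iff (hR.comp measurable_prodMk_left)).1 h0)
  have : ∀ᵐ f ∂(prior.restrict B), False := by
    filter_upwards [hω, h1] with f h2 h3 using h2 h3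
  simpa using this

theorem IsVersion.ae_evidence_lt_top [IsProbabilityMeasure P] [IsProbabilityMeasure prior]
    (hp : IsVersion p) (hYm : ∀ i, Measurable (Y i))
    (hYindep : iIndepFun Y P) (hYlaw : ∀ i, P.map (Y i) = fstar.law) (n : ℕ) :
    ∀ᵐ ω ∂P, ∫⁻ f, likelihoodRatio p fstar n (fun i => Y i ω) f ∂prior < ∞ :=
  ae_lt_top (hp.measurable_likelihoodRatio hYm n).lintegral_prod_right'
    (ne_top_of_le_ne_top (measure_ne_top prior univ)
      (hp.lintegral_likelihoodRatio_le hYm hYindep hYlaw prior n))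

/-- The integrated likelihood and the integrated likelihood ratio differ by the factor
`∏ f⋆(Y_i)`, which is almost surely positive and finite. -/
theorem IsVersion.ae_setLIntegral_likelihood (hp : IsVersion p) (hYm : ∀ i, Measurable (Y i))
    (hYlaw : ∀ i, P.map (Y i) = fstar.law) (n : ℕ) :
    ∀ᵐ ω ∂P, ∃ c : ℝ≥0∞, c ≠ 0 ∧ c ≠ ∞ ∧ ∀ A : Set (Density μ),
      ∫⁻ f in A, likelihood p n (fun i => Y i ω) f ∂prior
        = c * ∫⁻ f in A, likelihoodRatio p fstar n (fun i => Y i ω) f ∂prior := by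
  filter_upwards [ae_comp_of_law hYm hYlaw (ae_law_pos fstar)] with ω hω
  refine ⟨∏ i ∈ Finset.range n, (fstar (Y i ω) : ℝ≥0∞), ?_, ?_, fun A => ?_⟩
  · exact Finset.prod_ne_zero_iff.2 fun i _ => ENNReal.coe_ne_zero.2 (hω i)
  · exact ENNReal.prod_ne_top fun i _ => ENNReal.coe_ne_top
  · refine Eq.trans (lintegral_congr fun f => ?_) (lintegral_const_mul _
      ((hp.measurable_likelihoodRatio hYm n).comp measurable_prodMk_left))
    rw [likelihood, likelihoodRatio, ← Finset.prod_mul_distrib]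
    exact Finset.prod_congr rfl fun i _ =>
      (ENNReal.mul_div_cancel (ENNReal.coe_ne_zero.2 (hω i)) ENNReal.coe_ne_top).symm

theorem IsVersion.ae_posterior_eq (hp : IsVersion p) (hYm : ∀ i, Measurable (Y i))
    (hYlaw : ∀ i, P.map (Y i) = fstar.law) (n : ℕ) (A : Set (Density μ)) :
    ∀ᵐ ω ∂P, posterior prior p n (fun i => Y i ω) A
      = (∫⁻ f in A, likelihoodRatio p fstar n (fun i => Y i ω) f ∂prior)
        / ∫⁻ f, likelihoodRatio p fstar n (fun i => Y i ω) f ∂prior := by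
  filter_upwards [hp.ae_setLIntegral_likelihood (prior := prior) hYm hYlaw n]
    with ω ⟨c, hc0, hct, hc⟩
  have hu := hc univ
  simp only [Measure.restrict_univ] at hu
  rw [posterior, hc A, hu, ENNReal.mul_div_mul_left _ _ hc0 hct]

end Evidence

/-! ### The numerator of the posterior -/

/-- A ratio of integrals like a posterior mass is at most `1`, hence at most its power with exponent
`s ≤ 1`. This is what makes powers of the prior masses appear. -/
theorem setLIntegral_div_le {α : Type*} [MeasurableSpace α] {ν : Measure α} {R : α → ℝ≥0∞}
    (hDt : ∫⁻ f, R f ∂ν < ∞) {d : ℝ≥0∞}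
    (hd0 : d ≠ 0) (hd1 : d ≤ 1) (hd : d ≤ ∫⁻ f, R f ∂ν) {s : ℝ} (hs0 : 0 < s) (hs1 : s ≤ 1)
    {T N : Set (α)} {𝒜 : Set (Set (α))} (h𝒜 : 𝒜.Countable)
    (hT : T ⊆ N ∪ ⋃₀ 𝒜) :
    (∫⁻ f in T, R f ∂ν) / ∫⁻ f, R f ∂ν
      ≤ d⁻¹ * (∫⁻ f in N, R f ∂ν + ∑' A : 𝒜, (∫⁻ f in (A : Set _) ∩ T, R f ∂ν) ^ s) := by
  have : Countable 𝒜 := h𝒜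
  set D := ∫⁻ f, R f ∂ν with hD
  have hD0 : D ≠ 0 := fun h => hd0 (le_zero_iff.1 (h ▸ hd))
  have hsub : T ⊆ N ∪ ⋃ A : 𝒜, (A : Set (α)) ∩ T := by
    intro f hf
    rcases hT hf with h | ⟨A, hA, hfA⟩
    · exact Or.inl h
    · exact Or.inr (mem_iUnion.2 ⟨⟨A, hA⟩, hfA, hf⟩)
  have hterm (A : Set (α)) :
      (∫⁻ f in A, R f ∂ν) * D⁻¹ ≤ d⁻¹ * (∫⁻ f in A, R f ∂ν) ^ s := by
    have hle1 : (∫⁻ f in A, R f ∂ν) * D⁻¹ ≤ 1 := by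
      rw [← ENNReal.mul_inv_cancel hD0 hDt.ne]
      gcongr
      exact setLIntegral_le_lintegral _ _
    calc (∫⁻ f in A, R f ∂ν) * D⁻¹ ≤ ((∫⁻ f in A, R f ∂ν) * D⁻¹) ^ s :=
by
          simpa using ENNReal.rpow_le_rpow_of_exponent_ge hle1 hs1
      _ ≤ ((∫⁻ f in A, R f ∂ν) * d⁻¹) ^ s := by gcongr
      _ = (d⁻¹) ^ s * (∫⁻ f in A, R f ∂ν) ^ s := by
          rw [ENNReal.mul_rpow_of_nonneg _ _ hs0.le, mul_comm]
      _ ≤ d⁻¹ * (∫⁻ f in A, R f ∂ν) ^ s := by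
          gcongr
          simpa using ENNReal.rpow_le_rpow_of_exponent_le (ENNReal.one_le_inv.2 hd1) hs1
  calc (∫⁻ f in T, R f ∂ν) / D
      ≤ (∫⁻ f in N, R f ∂ν + ∑' A : 𝒜, ∫⁻ f in (A : Set _) ∩ T, R f ∂ν) * D⁻¹ := by
        rw [ENNReal.div_eq_inv_mul, mul_comm]
        gcongr
        exact (lintegral_mono_set hsub).trans ((lintegral_union_le _ _ _).trans
          (add_le_add le_rfl (lintegral_iUnion_le _ _)))
    _ = (∫⁻ f in N, R f ∂ν) * D⁻¹
          + ∑' A : 𝒜, (∫⁻ f in (A : Set _) ∩ T, R f ∂ν) * D⁻¹ := by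
        rw [add_mul, ENNReal.tsum_mul_right]
    _ ≤ d⁻¹ * (∫⁻ f in N, R f ∂ν)
          + ∑' A : 𝒜, d⁻¹ * (∫⁻ f in (A : Set _) ∩ T, R f ∂ν) ^ s := by
        refine add_le_add ?_ (ENNReal.tsum_le_tsum fun A => hterm _)
        rw [mul_comm]
        gcongr
    _ = _ := by rw [ENNReal.tsum_mul_left, mul_add]

section Numerator

variable {𝕐 : Type*} [MeasurableSpace 𝕐] {μ : Measure 𝕐}
  {p : Density μ → 𝕐 → ℝ≥0} {fstar : Density μ} {Ω : Type*} [MeasurableSpace Ω] {P : Measure Ω}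
  {Y : ℕ → Ω → 𝕐} {prior : Measure (Density μ)}

/-- The expected contribution of the part of a small ball that is far from `f⋆`. -/
theorem IsVersion.lintegral_far_ball_le [SigmaFinite μ] [IsProbabilityMeasure P]
    [IsProbabilityMeasure prior]
    (hp : IsVersion p)
    (hYm : ∀ i, Measurable (Y i)) (hYindep : iIndepFun Y P) (hYlaw : ∀ i, P.map (Y i) = fstar.law)
    {δ M : ℝ} (hδ : 0 ≤ δ) (hM : 2 ≤ M) {A : Set (Density μ)} (hA : MeasurableSet A)
    {f₀ : Density μ} (hball : ∀ f ∈ A, dist f f₀ ≤ δ) (n : ℕ) {s : ℝ} (hs0 : 0 < s)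
    (hs1 : s ≤ 1) :
    ∫⁻ ω, (∫⁻ f in A ∩ {f | M * δ ≤ dist fstar f},
        likelihoodRatio p fstar n (fun i => Y i ω) f ∂prior) ^ s ∂P
      ≤ ENNReal.ofReal (Real.exp (-(min s (1 - s) * (M - 2) ^ 2 * (n * δ ^ 2)))) * prior A ^ s := by
  rcases (A ∩ {f | M * δ ≤ dist fstar f}).eq_empty_or_nonempty with h0 | ⟨f₁, hf₁A, hf₁⟩
  · simp [h0, ENNReal.zero_rpow_of_pos hs0]
  have hT : MeasurableSet {f : Density μ | M * δ ≤ dist fstar f} :=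
    (isClosed_le continuous_const (continuous_const.dist continuous_id)).measurableSet
  have hfar : δ + (M - 2) * δ ≤ dist f₀ fstar := by
    have h1 := hball f₁ hf₁A
    have h2 : M * δ ≤ dist fstar f₁ := hf₁
    have h3 := dist_triangle_left fstar f₁ f₀
    rw [dist_comm f₀ fstar]
    rw [dist_comm f₀ fstar, dist_comm f₀ f₁] at h3
    linarith
  have hν : ∀ᵐ f ∂(prior.restrict (A ∩ {f | M * δ ≤ dist fstar f})), dist f f₀ ≤ δ := by
    filter_upwards [ae_restrict_mem (hA.inter hT)] with f hf using hball f hf.1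
  refine (hp.lintegral_rpow_likelihoodRatio_le hYm hYindep hYlaw hδ
    (mul_nonneg (by linarith) hδ) hν hfar n hs0.le hs1).trans ?_
  rw [Measure.restrict_apply_univ, mul_comm]
  gcongr ?_ * ?_
  · refine le_of_eq ?_
    congr 2
    ring
  · gcongr
    exact inter_subset_left

/-- Markov's inequality for the bound on the posterior mass far from `f⋆`, at a fixed sample
size. -/
theorem IsVersion.measure_posterior_far_le [SigmaFinite μ] [IsProbabilityMeasure P]
    [IsProbabilityMeasure prior]
    (hp : IsVersion p)
    (hYm : ∀ i, Measurable (Y i)) (hYindep : iIndepFun Y P) (hYlaw : ∀ i, P.map (Y i) = fstar.law)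
    {δ M : ℝ} (hδ : 0 ≤ δ) (hM : 2 ≤ M) {N : Set (Density μ)} {𝒜 : Set (Set (Density μ))}
    (h𝒜 : 𝒜.Countable)
    (hball : ∀ A ∈ 𝒜, MeasurableSet A ∧ ∃ f₀, ∀ f ∈ A, dist f f₀ ≤ δ)
    (hcover : {f | M * δ ≤ dist fstar f} ⊆ N ∪ ⋃₀ 𝒜) (n : ℕ) {s : ℝ} (hs0 : 0 < s)
    (hs1 : s ≤ 1) {d : ℝ≥0∞} (hd0 : d ≠ 0) (hd1 : d ≤ 1) {η : ℝ≥0∞} (hη : η ≠ 0) :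
    P {ω | η < posterior prior p n (fun i => Y i ω) {f | M * δ ≤ dist fstar f}}
      ≤ P {ω | ∫⁻ f, likelihoodRatio p fstar n (fun i => Y i ω) f ∂prior < d}
        + d⁻¹ * (prior N + ENNReal.ofReal
            (Real.exp (-(min s (1 - s) * (M - 2) ^ 2 * (n * δ ^ 2)))) *
            ∑' A : 𝒜, prior (A : Set (Density μ)) ^ s) / η := by
  have : Countable 𝒜 := h𝒜
  rcases eq_or_ne η ∞ with rfl | hηt
  · simp
  set T : Set (Density μ) := {f | M * δ ≤ dist fstar f} with hTdef
  have hJ (ν : Measure (Density μ)) [SFinite ν] :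
      Measurable fun ω => ∫⁻ f, likelihoodRatio p fstar n (fun i => Y i ω) f ∂ν :=
    (hp.measurable_likelihoodRatio hYm n).lintegral_prod_right'
  let W : Ω → ℝ≥0∞ := fun ω =>
    d⁻¹ * (∫⁻ f in N, likelihoodRatio p fstar n (fun i => Y i ω) f ∂prior
      + ∑' A : 𝒜, (∫⁻ f in (A : Set _) ∩ T,
          likelihoodRatio p fstar n (fun i => Y i ω) f ∂prior) ^ s)
  have hsumm : Measurable fun ω => ∑' A : 𝒜, (∫⁻ f in (A : Set _) ∩ T,
      likelihoodRatio p fstar n (fun i => Y i ω) f ∂prior) ^ s :=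
    Measurable.tsum fun A => (hJ _).pow_const s
  have hadd : Measurable fun ω =>
      ∫⁻ f in N, likelihoodRatio p fstar n (fun i => Y i ω) f ∂prior
        + ∑' A : 𝒜, (∫⁻ f in (A : Set _) ∩ T,
          likelihoodRatio p fstar n (fun i => Y i ω) f ∂prior) ^ s := (hJ _).add hsumm
  have hW : Measurable W := hadd.const_mul _
  have hWint : ∫⁻ ω, W ω ∂P ≤ d⁻¹ * (prior N + ENNReal.ofReal
            (Real.exp (-(min s (1 - s) * (M - 2) ^ 2 * (n * δ ^ 2)))) *
            ∑' A : 𝒜, prior (A : Set (Density μ)) ^ s) := by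
    rw [lintegral_const_mul _ hadd, lintegral_add_left (hJ _),
      lintegral_tsum fun A => ((hJ _).pow_const s).aemeasurable, ← ENNReal.tsum_mul_left]
    gcongr with A
    · refine (hp.lintegral_likelihoodRatio_le hYm hYindep hYlaw _ n).trans_eq ?_
      exact Measure.restrict_apply_univ N
    · obtain ⟨hA, f₀, hf₀⟩ := hball A A.2
      exact hp.lintegral_far_ball_le hYm hYindep hYlaw hδ hM hA hf₀ n hs0 hs1
  calc P {ω | η < posterior prior p n (fun i => Y i ω) T}
      ≤ P ({ω | ∫⁻ f, likelihoodRatio p fstar n (fun i => Y i ω) f ∂prior < d}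
          ∪ {ω | η ≤ W ω}) := by
        refine measure_mono_ae ?_
        filter_upwards [hp.ae_posterior_eq (prior := prior) hYm hYlaw n T,
          hp.ae_evidence_lt_top (prior := prior) hYm hYindep hYlaw n] with ω h1 h2 h3
        rcases lt_or_ge (∫⁻ f, likelihoodRatio p fstar n (fun i => Y i ω) f ∂prior) d with h4 | h4
        · exact Or.inl h4
        · refine Or.inr ?_
          change η < posterior prior p n (fun i => Y i ω) T at h3
          rw [h1] at h3
          exact h3.le.trans (setLIntegral_div_le h2 hd0 hd1 h4 hs0 hs1 h𝒜 hcover)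
    _ ≤ _ := measure_union_le _ _
    _ ≤ _ := by
        gcongr
        exact (meas_ge_le_lintegral_div hW.aemeasurable hη hηt).trans (by gcongr)

end Numerator

/-! ### The conditions S and P -/

section Conditions

variable {𝕐 : Type*} [MeasurableSpace 𝕐] {μ : Measure 𝕐}

/-- The common consequence of the conditions S and P that drives the contraction of the posterior:
the densities at distance more than `ε_n` from `f⋆` are covered by a remainder `N n` of
exponentially small prior mass and countably many sets `𝒜 n` inside `ε_n`-balls, for which the
prior masses to the power `s < 1` add up to at most an exponential. All properties are required for
large `n` only. -/
structure IsGoodCover (prior : Measure (Density μ)) (fstar : Density μ) (ε : ℕ → ℝ)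
    (r D s c : ℝ) (N : ℕ → Set (Density μ)) (𝒜 : ℕ → Set (Set (Density μ))) : Prop where
  exponent_pos : 0 < s
  exponent_lt_one : s < 1
  countable : ∀ᶠ n in atTop, (𝒜 n).Countable
  ball : ∀ᶠ n in atTop, ∀ A ∈ 𝒜 n, MeasurableSet A ∧ ∃ f₀, ∀ f ∈ A, dist f f₀ ≤ ε n
  cover : ∀ᶠ n in atTop, {f | ε n < dist fstar f} ⊆ N n ∪ ⋃₀ 𝒜 n
  remainder : ∀ᶠ n : ℕ in atTop,
    prior (N n) ≤ ENNReal.ofReal (D * Real.exp (-(r * (n * ε n ^ 2))))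
  summable : Tendsto (fun n : ℕ => ENNReal.ofReal (Real.exp (-(c * (n * ε n ^ 2)))) *
    ∑' A : 𝒜 n, prior (A : Set (Density μ)) ^ s) atTop (𝓝 0)

/-- `e^{-a u_n} → 0` as `n → ∞`, in `[0, ∞]`. -/
theorem tendsto_ofReal_exp_neg {u : ℕ → ℝ} (hu : Tendsto u atTop atTop) {a : ℝ}
    (ha : 0 < a) :
    Tendsto (fun n => ENNReal.ofReal (Real.exp (-(a * u n)))) atTop (𝓝 0) := by
  rw [← ENNReal.ofReal_zero]
  exact ENNReal.tendsto_ofReal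
    (Real.tendsto_exp_neg_atTop_nhds_zero.comp (hu.const_mul_atTop ha))

/-- Under condition S the remainder is the complement of the sieve, the sets are the balls of a
minimal cover of the sieve, and `s = 1 / 2`; bounding each prior mass by `1`, the sum is at most the
covering number. -/
theorem ConditionS.exists_isGoodCover {prior : Measure (Density μ)} [IsProbabilityMeasure prior]
    {ε : ℕ → ℝ} {C : ℝ} (hS : ConditionS prior ε C) (fstar : Density μ) (hε : ∀ n, 0 < ε n)
    (hu : Tendsto (fun n : ℕ => n * ε n ^ 2) atTop atTop) :
    ∃ r > C + 1, ∃ D s c N 𝒜, IsGoodCover prior fstar ε r D s c N 𝒜 := by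
  obtain ⟨S, -, ⟨r, hr, D, -, hrem⟩, R, -, hcov⟩ := hS
  have hne (n : ℕ) : ∃ T : Set (Density μ), Metric.IsCover (ε n).toNNReal (S n) T ∧
      T.encard = Metric.externalCoveringNumber (ε n).toNNReal (S n) := by
    have : Nonempty {T : Set (Density μ) // Metric.IsCover (ε n).toNNReal (S n) T} :=
      ⟨⟨S n, Metric.IsCover.rfl⟩⟩
    obtain ⟨T, hT⟩ := ENat.exists_eq_iInf
      fun T : {T : Set (Density μ) // Metric.IsCover (ε n).toNNReal (S n) T} =>
        (T : Set (Density μ)).encard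
    refine ⟨T, T.2, ?_⟩
    rw [hT, Metric.externalCoveringNumber, iInf_subtype]
  choose T hT hTcard using hne
  have hcard : ∀ᶠ n in atTop, ((T n).encard : ℝ≥0∞)
      ≤ ENNReal.ofReal (Real.exp (R * (n * ε n ^ 2))) := by
    filter_upwards [hcov] with n hn
    rw [hTcard n, ← ENNReal.log_le_log_iff, ENNReal.log_ofReal_of_pos (Real.exp_pos _),
      Real.log_exp]
    exact hn
  have hfin : ∀ᶠ n in atTop, (T n).Finite := by
    filter_upwards [hcard] with n hn
    rw [← Set.encard_ne_top_iff]
    intro htop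
    rw [htop] at hn
    exact absurd hn (by simp)
  refine ⟨r, hr, D, 1 / 2, R + 1, fun n => (S n)ᶜ,
    fun n => (fun f₀ => Metric.closedBall f₀ (ε n)) '' T n, by norm_num, by norm_num, ?_, ?_, ?_,
    ?_, ?_⟩
  · filter_upwards [hfin] with n hn using (hn.image _).countable
  · refine Eventually.of_forall fun n => ?_
    rintro _ ⟨f₀, -, rfl⟩
    exact ⟨Metric.isClosed_closedBall.measurableSet, f₀, fun f hf => hf⟩
  · refine Eventually.of_forall fun n f _ => ?_
    by_cases hf : f ∈ S n
    · obtain ⟨f₀, hf₀, hd⟩ := hT n hf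
      refine Or.inr ⟨_, ⟨f₀, hf₀, rfl⟩, ?_⟩
      change edist f f₀ ≤ ENNReal.ofReal (ε n) at hd
      rwa [edist_dist, ENNReal.ofReal_le_ofReal_iff (hε n).le] at hd
    · exact Or.inl hf
  · filter_upwards [hrem] with n hn
    rwa [← mul_assoc]
  · refine tendsto_of_tendsto_of_tendsto_of_le_of_le' tendsto_const_nhds
      (tendsto_ofReal_exp_neg hu one_pos) (Eventually.of_forall fun n => zero_le) ?_
    filter_upwards [hcard] with n hn
    have hsum : ∑' A : (fun f₀ => Metric.closedBall f₀ (ε n)) '' T n,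
        prior (A : Set (Density μ)) ^ (1 / 2 : ℝ) ≤ ENNReal.ofReal (Real.exp (R * (n * ε n ^ 2))) :=
      calc _ ≤ ∑' _ : (fun f₀ => Metric.closedBall f₀ (ε n)) '' T n, (1 : ℝ≥0∞) :=
            ENNReal.tsum_le_tsum fun A => ENNReal.rpow_le_one prob_le_one (by norm_num)
        _ = (((fun f₀ => Metric.closedBall f₀ (ε n)) '' T n).encard : ℝ≥0∞) :=
            ENNReal.tsum_set_one _
        _ ≤ ((T n).encard : ℝ≥0∞) := by
            gcongr
            exact Set.encard_image_le _ _
        _ ≤ _ := hn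
    calc _ ≤ ENNReal.ofReal (Real.exp (-((R + 1) * (n * ε n ^ 2)))) *
          ENNReal.ofReal (Real.exp (R * (n * ε n ^ 2))) := by gcongr
      _ = _ := by
          rw [← ENNReal.ofReal_mul (Real.exp_nonneg _), ← Real.exp_add]
          ring_nf

/-- Under condition P there is no remainder, so that its rate `r` is arbitrary, and `s = 1 / β`. -/
theorem ConditionP.exists_isGoodCover {prior : Measure (Density μ)} {fstar : Density μ}
    {ε : ℕ → ℝ} (hP : ConditionP prior fstar ε) (r : ℝ) :
    ∃ D s c N 𝒜, IsGoodCover prior fstar ε r D s c N 𝒜 := by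
  obtain ⟨δ, 𝒜, h𝒜, c, -, β, hβ, hsum⟩ := hP
  refine ⟨0, 1 / β, c, fun _ => ∅, 𝒜, by positivity, (div_lt_one (by linarith)).2 hβ, ?_, ?_, ?_,
    ?_, ?_⟩
  · filter_upwards [h𝒜] with n hn using hn.2.2.1
  · filter_upwards [h𝒜] with n hn A hA
    obtain ⟨f₀, rfl | rfl⟩ := hn.2.2.2.1 A hA
    · refine ⟨(isOpen_lt (continuous_const.dist continuous_id) continuous_const).measurableSet,
        f₀, fun f hf => ?_⟩
      rw [dist_comm]
      exact (le_of_lt hf.out).trans hn.2.1.le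
    · refine ⟨(isClosed_le (continuous_const.dist continuous_id) continuous_const).measurableSet,
        f₀, fun f hf => ?_⟩
      rw [dist_comm]
      exact (show dist f₀ f ≤ δ n from hf).trans hn.2.1.le
  · filter_upwards [h𝒜] with n hn
    rw [empty_union]
    exact hn.2.2.2.2
  · simp
  · simpa only [mul_assoc] using hsum

end Conditions

/-! ### Posterior contraction -/

section Contraction

variable {𝕐 : Type*} [MeasurableSpace 𝕐] {μ : Measure 𝕐}
  {p : Density μ → 𝕐 → ℝ≥0} {fstar : Density μ} {Ω : Type*} [MeasurableSpace Ω] {P : Measure Ω}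
  [IsProbabilityMeasure P] {Y : ℕ → Ω → 𝕐} {prior : Measure (Density μ)}
  [IsProbabilityMeasure prior] {ε : ℕ → ℝ} {C : ℝ}

theorem IsThick.ae_denominator (hthick : IsThick prior fstar ε C) (hp : IsVersion p)
    (hYm : ∀ i, Measurable (Y i)) (hYindep : iIndepFun Y P)
    (hYlaw : ∀ i, P.map (Y i) = fstar.law) :
    ∀ᶠ n : ℕ in atTop, ∀ᵐ ω ∂P, 0 < ∫⁻ f, likelihood p n (fun i => Y i ω) f ∂prior ∧
      ∫⁻ f, likelihood p n (fun i => Y i ω) f ∂prior < ∞ := by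
  filter_upwards [hthick.mass] with n hn
  have hpos : prior {f | fstar.law ≪ f.law} ≠ 0 := by
    refine ((ENNReal.ofReal_pos.2 (Real.exp_pos _)).trans_le
      (hn.trans (measure_mono fun f hf => ?_))).ne'
    exact absolutelyContinuous_of_K_ne_top (ne_top_of_le_ne_top ENNReal.ofReal_ne_top hf.1)
  filter_upwards [hp.ae_evidence_pos hYm hYlaw n hpos,
    hp.ae_evidence_lt_top (prior := prior) hYm hYindep hYlaw n,
    hp.ae_setLIntegral_likelihood (prior := prior) hYm hYlaw n] with ω h1 h2 ⟨c, hc0, hct, hc⟩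
  have hu := hc univ
  simp only [Measure.restrict_univ] at hu
  rw [hu]
  exact ⟨ENNReal.mul_pos hc0 h1.ne', ENNReal.mul_lt_top hct.lt_top h2⟩

/-- The condition `C + 1 < r` makes the remainder negligible against the denominator, which is of
order at least `e^{-(C + 1 + a) u_n}` for every `a > 0`. -/
theorem IsGoodCover.tendsto_posterior [SigmaFinite μ] {r D s c : ℝ} {N : ℕ → Set (Density μ)}
    {𝒜 : ℕ → Set (Set (Density μ))} (hcover : IsGoodCover prior fstar ε r D s c N 𝒜)
    (hr : C + 1 < r) (hthick : IsThick prior fstar ε C) (hp : IsVersion p)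
    (hYm : ∀ i, Measurable (Y i)) (hYindep : iIndepFun Y P)
    (hYlaw : ∀ i, P.map (Y i) = fstar.law) :
    ∃ M : ℝ, 0 < M ∧ ∀ η : ℝ≥0∞, 0 < η → Tendsto (fun n : ℕ =>
        P {ω | η < posterior prior p n (fun i => Y i ω) {f | M * ε n ≤ dist fstar f}})
      atTop (𝓝 0) := by
  obtain ⟨hs0, hs1, hcount, hball, hcov, hrem, hsum⟩ := hcover
  set u : ℕ → ℝ := fun n => n * ε n ^ 2 with hu
  have hutop : Tendsto u atTop atTop := hthick.tendsto_atTop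
  -- The margin `a` leaves room for the denominator bound `e^{-(C + 1 + a) u_n} / 2` between
  -- `C + 1` and `r`.
  set a : ℝ := (r - (C + 1)) / 2 with ha
  have ha0 : 0 < a := by rw [ha]; linarith
  set q : ℝ := C + 1 + a with hq
  have hq0 : 0 < q := by have := hthick.const_pos; linarith
  have hqr : 0 < r - q := by rw [hq, ha]; linarith
  set κ : ℝ := min s (1 - s) with hκ
  have hκ0 : 0 < κ := lt_min hs0 (by linarith)
  -- `M` is chosen so that the gain `κ (M - 2)²` pays for the denominator and for the sum.
  obtain ⟨x, hx0, hx⟩ : ∃ x : ℝ, 0 ≤ x ∧ q + c ≤ κ * x ^ 2 := by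
    refine ⟨√(|q + c| / κ), Real.sqrt_nonneg _, ?_⟩
    rw [Real.sq_sqrt (by positivity), mul_div_cancel₀ _ hκ0.ne']
    exact le_abs_self _
  refine ⟨x + 2, by linarith, fun η hη => ?_⟩
  set w : ℕ → ℝ≥0∞ := fun n => ∑' A : 𝒜 n, prior (A : Set (Density μ)) ^ s with hw
  let bound : ℕ → ℝ≥0∞ := fun n => 2 * ENNReal.ofReal (1 / (a ^ 2 * u n)) +
    2 * (ENNReal.ofReal D * ENNReal.ofReal (Real.exp (-((r - q) * u n)))
      + ENNReal.ofReal (Real.exp (-(c * u n))) * w n) / η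
  have hbound : Tendsto bound atTop (𝓝 0) := by
    have h1 : Tendsto (fun n => ENNReal.ofReal (1 / (a ^ 2 * u n))) atTop (𝓝 0) := by
      rw [← ENNReal.ofReal_zero]
      refine ENNReal.tendsto_ofReal ?_
      simp only [one_div]
      exact tendsto_inv_atTop_zero.comp (hutop.const_mul_atTop (by positivity))
    have h2 := ENNReal.Tendsto.const_mul (tendsto_ofReal_exp_neg hutop hqr)
      (Or.inr (ENNReal.ofReal_ne_top (r := D)))
    have h3 := ENNReal.Tendsto.div_const
      (ENNReal.Tendsto.const_mul (h2.add hsum) (Or.inr (ENNReal.ofNat_ne_top (n := 2))))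
      (Or.inr hη.ne')
    have h4 : Tendsto bound atTop (𝓝 (2 * 0 + 2 * (ENNReal.ofReal D * 0 + 0) / η)) :=
      (ENNReal.Tendsto.const_mul h1 (Or.inr (ENNReal.ofNat_ne_top (n := 2)))).add h3
    simpa only [mul_zero, add_zero, ENNReal.zero_div] using h4
  refine tendsto_of_tendsto_of_tendsto_of_le_of_le' tendsto_const_nhds hbound
    (Eventually.of_forall fun n => zero_le) ?_
  filter_upwards [hcount, hball, hcov, hrem, hthick.mass, eventually_gt_atTop 0]
    with n hcount hball hcov hrem hmass hn
  have hun : 0 < u n := mul_pos (Nat.cast_pos.2 hn) (pow_pos (hthick.pos n) 2)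
  set d : ℝ≥0∞ := ENNReal.ofReal (Real.exp (-((1 + a) * u n)))
    * (ENNReal.ofReal (Real.exp (-(C * n * ε n ^ 2))) / 2) with hd
  have hd' : d = ENNReal.ofReal (Real.exp (-(q * u n))) / 2 := by
    rw [hd, ← mul_div_assoc, ← ENNReal.ofReal_mul (Real.exp_nonneg _), ← Real.exp_add, hq]
    congr 3
    simp only [hu]
    ring
  have hd0 : d ≠ 0 := by
    rw [hd']
    exact (ENNReal.div_pos (ENNReal.ofReal_pos.2 (Real.exp_pos _)).ne' (by simp)).ne'
  have hd1 : d ≤ 1 := by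
    rw [hd']
    refine ENNReal.half_le_self.trans ?_
    rw [ENNReal.ofReal_le_one, Real.exp_le_one_iff]
    linarith [mul_pos hq0 hun]
  have hdinv : d⁻¹ = 2 * ENNReal.ofReal (Real.exp (q * u n)) := by
    rw [hd', ENNReal.inv_div (by simp) (by simp), Real.exp_neg,
      ENNReal.ofReal_inv_of_pos (Real.exp_pos _), div_eq_mul_inv, inv_inv]
  have hε := hthick.pos n
  have hcov' : {f | (x + 2) * ε n ≤ dist fstar f} ⊆ N n ∪ ⋃₀ 𝒜 n := by
    refine fun f hf => hcov ?_
    have : (x + 2) * ε n ≤ dist fstar f := hf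
    change ε n < dist fstar f
    nlinarith
  refine (hp.measure_posterior_far_le hYm hYindep hYlaw hε.le (by linarith) hcount hball hcov' n
    hs0 hs1.le hd0 hd1 hη.ne').trans ?_
  have hev := hp.measure_evidence_lt_le hYm hYindep hYlaw hn (pow_pos hε 2) ha0
    (ENNReal.ofReal_pos.2 (Real.exp_pos _)).ne' hmass
  refine add_le_add hev ?_
  gcongr ?_ / η
  rw [hdinv, mul_assoc]
  gcongr
  rw [mul_add]
  gcongr ?_ + ?_
  · calc _ ≤ ENNReal.ofReal (Real.exp (q * u n))
          * ENNReal.ofReal (D * Real.exp (-(r * u n))) := by gcongr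
      _ = _ := by
        rw [mul_comm, ENNReal.ofReal_mul' (Real.exp_nonneg _), mul_assoc,
          ← ENNReal.ofReal_mul (Real.exp_nonneg _), ← Real.exp_add]
        ring_nf
  · rw [← mul_assoc, ← ENNReal.ofReal_mul (Real.exp_nonneg _), ← Real.exp_add]
    gcongr
    have := mul_le_mul_of_nonneg_right hx hun.le
    rw [add_sub_cancel_right]
    change q * u n + -(κ * x ^ 2 * u n) ≤ -(c * u n)
    linarith

end Contraction

end BayesRate

end

theorem theorem2
    {𝕐 : Type*} [TopologicalSpace 𝕐] [PolishSpace 𝕐] [MeasurableSpace 𝕐] [BorelSpace 𝕐]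
    (μ : Measure 𝕐) [SigmaFinite μ]
    (prior : Measure (BayesRate.Density μ)) [IsProbabilityMeasure prior]
    (p : BayesRate.Density μ → 𝕐 → ℝ≥0) (hp : BayesRate.IsVersion p)
    (fstar : BayesRate.Density μ)
    {Ω : Type*} [MeasurableSpace Ω] (P : Measure Ω) [IsProbabilityMeasure P]
    (Y : ℕ → Ω → 𝕐) (hYm : ∀ i, Measurable (Y i)) (hYindep : iIndepFun Y P)
    (hYlaw : ∀ i, P.map (Y i) = fstar.law)
    (ε : ℕ → ℝ) (C : ℝ) (hthick : BayesRate.IsThick prior fstar ε C)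
    (hcond : BayesRate.ConditionS prior ε C ∨ BayesRate.ConditionP prior fstar ε) :
    (∀ᶠ n : ℕ in atTop, ∀ᵐ ω ∂P,
      0 < ∫⁻ f, BayesRate.likelihood p n (fun i => Y i ω) f ∂prior ∧
      ∫⁻ f, BayesRate.likelihood p n (fun i => Y i ω) f ∂prior < ∞) ∧
    ∃ M : ℝ, 0 < M ∧ ∀ η : ℝ≥0∞, 0 < η → Tendsto (fun n : ℕ =>
        P {ω | η < BayesRate.posterior prior p n (fun i => Y i ω)
          {f | M * ε n ≤ BayesRate.hellinger fstar f}})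
      atTop (𝓝 0) := by
  refine ⟨hthick.ae_denominator hp hYm hYindep hYlaw, ?_⟩
  rcases hcond with hS | hP
  · obtain ⟨r, hr, D, s, c, N, 𝒜, h⟩ :=
      hS.exists_isGoodCover fstar hthick.pos hthick.tendsto_atTop
    exact h.tendsto_posterior hr hthick hp hYm hYindep hYlaw
  · obtain ⟨D, s, c, N, 𝒜, h⟩ := hP.exists_isGoodCover (C + 2)
    exact h.tendsto_posterior (by linarith) hthick hp hYm hYindep hYlaw
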